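/- **Theorem (the operators $\mathcal A_k$ for Schur functions).** Let $n\ge 1$, and for a partition $\lambda=(\lambda_1\ge\dots\ge\lambda_n\ge0)$ let $\bar s_\lambda=s_\lambda/s_\lambda(1,\dots,1)\in\mathbb C[x_1,\dots,x_n]^{S_n}$ be the normalized Schur polynomial, where $s_\lambda=\det(x_i^{\lambda_j+n-j})/\det(x_i^{n-j})$, and let $q_\lambda(z)=\bar s_\lambda(z,1,\dots,1)\in\mathbb C[z]$. There is a unique linear operator $Q_z:\mathbb C[x_1,\dots,x_n]^{S_n}\to\mathbb C[x_1,\dots,x_n]^{S_n}\otimes\mathbb C[z]$ with $Q_z\bar s_\lambda=q_\lambda(z)\,\bar s_\lambda$ for all $\lambda$. For $0\le k\le n$ let $\rho_k$ be the substitution $x_{k+1}=\dots=x_n=1$, a map from $\mathbb C[x_1,\dots,x_n]^{S_n}$ to $\mathbb C[x_1,\dots,x_k]^{S_k}$, extended linearly over the $z$-variables, and let $\mathcal S_n=\rho_0Q_{z_1}\cdots Q_{z_n}:\mathbb C[x_1,\dots,x_n]^{S_n}\to\mathbb C[z_1,\dots,z_n]$, so that $\mathcal S_n\bar s_\lambda=\prod_{j=1}^nq_\lambda(z_j)$.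 Then there is exactly one family of linear operators $$\mathcal A_k:\mathbb C[x_1,\dots,x_k]^{S_k}\to\mathbb C[x_1,\dots,x_{k-1}]^{S_{k-1}}\otimes\mathbb C[z_k],\qquad k=1,\dots,n,$$ such that $\rho_{k-1}Q_{z_k}=\mathcal A_k\rho_k$ for $k=1,\dots,n$, and it satisfies $\mathcal S_n=\mathcal A_1\mathcal A_2\cdots\mathcal A_n$. Moreover, for $1\le k\le n$, every $f\in\mathbb C[x_1,\dots,x_k]^{S_k}$, all real $1<\tilde y_1<\dots<\tilde y_{k-1}$ and all real $z_k>1$, the value of $\mathcal A_kf$ at $(\tilde{\mathbf y},z_k)$ is $$[\mathcal A_kf](\tilde{\mathbf y})=\frac{(-1)^{k-1}(n-1)!}{(n-k)!\,(z_k-1)^{n-1}\,\Delta_{k-1}(\tilde{\mathbf y})\prod_{j=1}^{k-1}(\tilde y_j-1)^{n-k+1}}\int_{\tilde\Omega}d\tilde{\mathbf x}\;\delta(\tilde x_1\cdots\tilde x_k-z_k\tilde y_1\cdots\tilde y_{k-1})\,\Delta_k(\tilde{\mathbf x})\prod_{j=1}^k(\tilde x_j-1)^{n-k}f(\tilde{\mathbf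 x}),$$ where $\Delta_m(\mathbf x)=\prod_{1\le i<j\le m}(x_i-x_j)$, the domain $\tilde\Omega\subset\mathbb R^k$ is given by $1<\tilde x_1<\tilde y_1<\tilde x_2<\tilde y_2<\dots<\tilde y_{k-1}<\tilde x_k$, and the integral with the Dirac delta function is the limit, as $\varepsilon\to0^+$, of the integrals with $\delta(s)$ replaced by $\varepsilon^{-1}\eta(s/\varepsilon)$, which exists and is the same for every real-valued $\eta\in C_c^\infty(\mathbb R)$ with $\int\eta=1$. -/

import Mathlib

open scoped TensorProduct ContDiff Polynomial Topology
open MvPolynomial (symmetricSubalgebra)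

namespace SchurSep

noncomputable section

/-! ### Symmetric polynomials, alternants and Schur functions -/

/-- `SymPoly m` is the algebra `ℂ[x₁, …, x_m]^{S_m}` of symmetric polynomials in `m` variables. -/
abbrev SymPoly (m : ℕ) : Subalgebra ℂ (MvPolynomial (Fin m) ℂ) := symmetricSubalgebra (Fin m) ℂ

/-- The Vandermonde product `Δ_m(x) = ∏_{i<j} (x_i - x_j)`. -/
def vdm {R : Type*} [CommRing R] {m : ℕ} (x : Fin m → R) : R :=
  ∏ i : Fin m, ∏ j ∈ Finset.Ioi i, (x i - x j)

/-- The alternant `a_{λ+δ}(x) = det (x_i ^ μ_j)`, where `μ_j = λ_j + n - j` for `j = 1, …, n`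
(with `j` counted from `0` this is `λ_j + (n - 1 - j)`). For `λ = 0` it is `a_δ`. -/
def alternant {n : ℕ} (lam : Fin n → ℕ) : MvPolynomial (Fin n) ℂ :=
  (Matrix.of fun i j : Fin n =>
    (MvPolynomial.X i : MvPolynomial (Fin n) ℂ) ^ (lam j + (n - 1 - (j : ℕ)))).det

theorem alternant_zero (n : ℕ) :
    alternant (0 : Fin n → ℕ) = vdm (MvPolynomial.X : Fin n → MvPolynomial (Fin n) ℂ) := by
  have h : alternant (0 : Fin n → ℕ) =
      (Matrix.vandermonde
        (fun i : Fin n => (MvPolynomial.X i.rev : MvPolynomial (Fin n) ℂ))).det := by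
    rw [alternant, ← Matrix.det_submatrix_equiv_self (Fin.revPerm (n := n))]
    congr 1
    ext1 i j
    simp only [Matrix.submatrix_apply, Matrix.of_apply, Matrix.vandermonde_apply, Pi.zero_apply,
      Fin.revPerm_apply, Fin.val_rev, zero_add]
    congr 1
    have := j.2
    omega
  rw [h, Matrix.det_vandermonde, vdm]
  rw [Finset.prod_sigma', Finset.prod_sigma']
  refine Finset.prod_bij' (fun p _ => ⟨p.2.rev, p.1.rev⟩) (fun p _ => ⟨p.2.rev, p.1.rev⟩)
    ?_ ?_ ?_ ?_ ?_ <;> simp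

theorem X_sub_X_dvd_iff {n : ℕ} {i j : Fin n} (p : MvPolynomial (Fin n) ℂ) :
    (MvPolynomial.X i - MvPolynomial.X j) ∣ p ↔
      MvPolynomial.aeval (R := ℂ) (Function.update
        (MvPolynomial.X : Fin n → MvPolynomial (Fin n) ℂ) i (MvPolynomial.X j)) p = 0 := by
  classical
  constructor
  · rintro ⟨q, rfl⟩
    by_cases hij : j = i
    · subst hij; simp
    · simp [Function.update_of_ne hij]
  · intro h
    rw [← Ideal.mem_span_singleton, ← Ideal.Quotient.eq_zero_iff_mem]
    set I := Ideal.span {(MvPolynomial.X i - MvPolynomial.X j : MvPolynomial (Fin n) ℂ)}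
    have key : (Ideal.Quotient.mkₐ ℂ I).comp (MvPolynomial.aeval (R := ℂ) (Function.update
        (MvPolynomial.X : Fin n → MvPolynomial (Fin n) ℂ) i (MvPolynomial.X j))) =
        Ideal.Quotient.mkₐ ℂ I := by
      refine MvPolynomial.algHom_ext fun k => ?_
      by_cases hk : k = i
      · subst hk
        simp only [AlgHom.comp_apply, MvPolynomial.aeval_X, Function.update_self,
          Ideal.Quotient.mkₐ_eq_mk]
        refine (Ideal.Quotient.eq.2 ?_).symm
        exact Ideal.mem_span_singleton_self _
      · simp [Function.update_of_ne hk]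
    have := congrArg (fun φ => φ p) key
    simp only [AlgHom.comp_apply, h, map_zero] at this
    exact this.symm

theorem X_sub_X_prime {n : ℕ} {i j : Fin n} (hij : i ≠ j) :
    Prime (MvPolynomial.X i - MvPolynomial.X j : MvPolynomial (Fin n) ℂ) := by
  refine ⟨?_, ?_, ?_⟩
  · exact sub_ne_zero.2 fun h => hij (MvPolynomial.X_injective h)
  · intro h
    have h0 := (X_sub_X_dvd_iff (i := i) (j := j) _).1 dvd_rfl
    have h1 := h.map (MvPolynomial.aeval (R := ℂ) (Function.update
        (MvPolynomial.X : Fin n → MvPolynomial (Fin n) ℂ) i (MvPolynomial.X j)))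
    rw [h0] at h1
    exact not_isUnit_zero h1
  · intro a b h
    rw [X_sub_X_dvd_iff, map_mul, mul_eq_zero] at h
    rwa [X_sub_X_dvd_iff, X_sub_X_dvd_iff]

theorem alternant_zero_dvd {n : ℕ} (lam : Fin n → ℕ) :
    alternant (0 : Fin n → ℕ) ∣ alternant lam := by
  classical
  rw [alternant_zero, vdm, Finset.prod_sigma']
  refine Finset.prod_dvd_of_isRelPrime ?_ ?_
  · rintro ⟨i, j⟩ hij ⟨k, l⟩ hkl hne
    simp only [Finset.coe_sigma, Set.mem_sigma_iff, Finset.coe_univ, Set.mem_univ,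
      Finset.coe_Ioi, Set.mem_Ioi, true_and] at hij hkl
    refine (X_sub_X_prime hij.ne).irreducible.isRelPrime_iff_not_dvd.2 fun h => ?_
    rw [X_sub_X_dvd_iff] at h
    simp only [map_sub, MvPolynomial.aeval_X, sub_eq_zero, Function.update_apply] at h
    split_ifs at h with h1 h2 h2
    · exact hkl.ne (h1.trans h2.symm)
    · have h3 : j = l := MvPolynomial.X_injective h
      subst h1 h3
      exact hne rfl
    · have h3 : k = j := MvPolynomial.X_injective h
      subst h2 h3
      exact lt_asymm hij hkl
    · exact hkl.ne (MvPolynomial.X_injective h)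
  · rintro ⟨i, j⟩ hij
    simp only [Finset.mem_sigma, Finset.mem_univ, Finset.mem_Ioi, true_and] at hij
    rw [X_sub_X_dvd_iff, alternant, AlgHom.map_det]
    refine Matrix.det_zero_of_row_eq hij.ne ?_
    funext l
    simp [Function.update_of_ne hij.ne']

theorem rename_alternant {n : ℕ} (lam : Fin n → ℕ) (e : Equiv.Perm (Fin n)) :
    MvPolynomial.rename e (alternant lam) = (Equiv.Perm.sign e : ℤ) • alternant lam := by
  rw [alternant, AlgHom.map_det]
  have := Matrix.det_permute e (Matrix.of fun i j : Fin n =>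
    (MvPolynomial.X i : MvPolynomial (Fin n) ℂ) ^ (lam j + (n - 1 - (j : ℕ))))
  rw [zsmul_eq_mul]
  convert this using 2
  ext1 i j
  simp

theorem alternant_zero_ne_zero (n : ℕ) : alternant (0 : Fin n → ℕ) ≠ 0 := by
  rw [alternant_zero, vdm]
  refine Finset.prod_ne_zero_iff.2 fun i _ => Finset.prod_ne_zero_iff.2 fun j hj => ?_
  exact (X_sub_X_prime (Finset.mem_Ioi.1 hj).ne).ne_zero

/-- The quotient `a_{λ+δ} / a_δ` exists, is unique, and is a symmetric polynomial. -/
theorem existsUnique_schur {n : ℕ} (lam : Fin n → ℕ) :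
    ∃! s : SymPoly n, alternant (0 : Fin n → ℕ) * (s : MvPolynomial (Fin n) ℂ) = alternant lam := by
  obtain ⟨s, hs⟩ := alternant_zero_dvd lam
  refine ⟨⟨s, fun e => ?_⟩, hs.symm, fun t ht => ?_⟩
  · have h := rename_alternant lam e
    rw [hs, map_mul, rename_alternant, ← smul_mul_assoc] at h
    refine mul_left_cancel₀ ?_ h
    rw [zsmul_eq_mul]
    refine mul_ne_zero ?_ (alternant_zero_ne_zero n)
    rcases Int.units_eq_one_or (Equiv.Perm.sign e) with h | h <;> simp [h]
  · exact Subtype.ext (mul_left_cancel₀ (alternant_zero_ne_zero n) (ht.trans hs))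

/-- The Schur function `s_λ = a_{λ+δ} / a_δ`, a symmetric polynomial in `n` variables. -/
def schur {n : ℕ} (lam : Fin n → ℕ) : SymPoly n := (existsUnique_schur lam).choose

theorem schur_spec {n : ℕ} (lam : Fin n → ℕ) :
    alternant (0 : Fin n → ℕ) * (schur lam : MvPolynomial (Fin n) ℂ) = alternant lam :=
  (existsUnique_schur lam).choose_spec.1

/-- `ρ₀ : f ↦ f(1, …, 1)`. -/
def evalOne (m : ℕ) : SymPoly m →ₗ[ℂ] ℂ :=
  (MvPolynomial.aeval fun _ : Fin m => (1 : ℂ)).toLinearMap ∘ₗ (SymPoly m).val.toLinearMap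

/-- The normalized Schur function `s̄_λ = s_λ / s_λ(1, …, 1)`. -/
def schurBar {n : ℕ} (lam : Fin n → ℕ) : SymPoly n := (evalOne n (schur lam))⁻¹ • schur lam

/-- The univariate polynomial `q_λ(z) = s̄_λ(z, 1, …, 1)`. -/
def qPoly {n : ℕ} (lam : Fin n → ℕ) : ℂ[X] :=
  MvPolynomial.aeval (fun i : Fin n => if (i : ℕ) = 0 then (Polynomial.X : ℂ[X]) else 1)
    (schurBar lam : MvPolynomial (Fin n) ℂ)

/-! ### The operators -/

/-- `Q : ℂ[x]^{S_n} → ℂ[x]^{S_n} ⊗ ℂ[z]` is the operator `Q_z`: the normalized Schur function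
`s̄_λ` is an eigenvector with eigenvalue `q_λ(z)`, for every partition `λ₁ ≥ … ≥ λ_n ≥ 0`. -/
def IsQOperator (n : ℕ) (Q : SymPoly n →ₗ[ℂ] SymPoly n ⊗[ℂ] ℂ[X]) : Prop :=
  ∀ lam : Fin n → ℕ, Antitone lam → Q (schurBar lam) = schurBar lam ⊗ₜ[ℂ] qPoly lam

/-- The substitution `x_{k+1} = … = x_n = 1` on all polynomials. -/
def restrictOne (n k : ℕ) : MvPolynomial (Fin n) ℂ →ₐ[ℂ] MvPolynomial (Fin k) ℂ :=
  MvPolynomial.aeval fun i : Fin n => if h : (i : ℕ) < k then MvPolynomial.X ⟨i, h⟩ else 1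

theorem restrictOne_mem {n k : ℕ} (hk : k ≤ n) (f : SymPoly n) :
    restrictOne n k f ∈ SymPoly k := by
  intro e
  let e' : Equiv.Perm (Fin n) := e.viaEmbedding (Fin.castLEEmb hk)
  have hf : MvPolynomial.rename e' (f : MvPolynomial (Fin n) ℂ) = f := f.2 e'
  conv_rhs => rw [← hf]
  have key : (MvPolynomial.rename e : MvPolynomial (Fin k) ℂ →ₐ[ℂ] _).comp (restrictOne n k) =
      (restrictOne n k).comp (MvPolynomial.rename e') := by
    refine MvPolynomial.algHom_ext fun i => ?_
    by_cases h : (i : ℕ) < k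
    · have h1 : e' i = Fin.castLEEmb hk (e ⟨i, h⟩) :=
        Equiv.Perm.viaEmbedding_apply e (Fin.castLEEmb hk) ⟨i, h⟩
      simp [restrictOne, h, h1]
    · have h1 : e' i = i := by
        refine Equiv.Perm.viaEmbedding_apply_of_notMem e (Fin.castLEEmb hk) i ?_
        rintro ⟨a, rfl⟩
        exact h a.2
      simp [restrictOne, h, h1]
  exact congrArg (fun φ => φ (f : MvPolynomial (Fin n) ℂ)) key

/-- `ρ_k : ℂ[x₁, …, x_n]^{S_n} → ℂ[x₁, …, x_k]^{S_k}`,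
`f ↦ f(x₁, …, x_k, 1, …, 1)`, for `0 ≤ k ≤ n`. -/
def rho (n k : ℕ) (hk : k ≤ n) : SymPoly n →ₗ[ℂ] SymPoly k :=
  LinearMap.codRestrict (Subalgebra.toSubmodule (SymPoly k))
    ((restrictOne n k).toLinearMap ∘ₗ (SymPoly n).val.toLinearMap) (restrictOne_mem hk)

/-- A family `A_k : ℂ[x₁, …, x_k]^{S_k} → ℂ[x₁, …, x_{k-1}]^{S_{k-1}} ⊗ ℂ[z_k]`, `k = 1, …, n`.
The index `j : Fin n` stands for `k = j + 1`. -/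
abbrev AFamily (n : ℕ) : Type :=
  (j : Fin n) → (SymPoly ((j : ℕ) + 1) →ₗ[ℂ] SymPoly (j : ℕ) ⊗[ℂ] ℂ[X])

/-- The relations `ρ_{k-1} Q_{z_k} = A_k ρ_k`, `k = 1, …, n`, where `ρ_{k-1}` acts on
`ℂ[x]^{S_n} ⊗ ℂ[z_k]` through the first factor. -/
def Intertwines {n : ℕ} (Q : SymPoly n →ₗ[ℂ] SymPoly n ⊗[ℂ] ℂ[X]) (A : AFamily n) : Prop :=
  ∀ j : Fin n, (rho n j j.2.le).rTensor ℂ[X] ∘ₗ Q = A j ∘ₗ rho n (j + 1) j.2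

/-- The action of an operator `T : M → N ⊗ ℂ[z_j]` from `M ⊗ ℂ[z₁, …, z_n]` to
`N ⊗ ℂ[z₁, …, z_n]`: it is linear over `ℂ[z₁, …, z_n]`, and the variable produced by `T` is `z_j`. -/
def atVar {n : ℕ} (j : Fin n) {M N : Type} [AddCommGroup M] [Module ℂ M] [AddCommGroup N]
    [Module ℂ N] (T : M →ₗ[ℂ] N ⊗[ℂ] ℂ[X]) :
    M ⊗[ℂ] MvPolynomial (Fin n) ℂ →ₗ[ℂ] N ⊗[ℂ] MvPolynomial (Fin n) ℂ :=
  LinearMap.lTensor N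
      (LinearMap.mul' ℂ (MvPolynomial (Fin n) ℂ) ∘ₗ
        LinearMap.rTensor (MvPolynomial (Fin n) ℂ)
          (Polynomial.aeval (MvPolynomial.X j : MvPolynomial (Fin n) ℂ)).toLinearMap) ∘ₗ
    (TensorProduct.assoc ℂ N ℂ[X] (MvPolynomial (Fin n) ℂ)).toLinearMap ∘ₗ
    LinearMap.rTensor (MvPolynomial (Fin n) ℂ) T

/-- Evaluation at `(1, …, 1)` of the `x`-variables,
`ℂ[x]^{S_m} ⊗ ℂ[z₁, …, z_n] → ℂ[z₁, …, z_n]`. -/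
def evalOneZ (m n : ℕ) :
    SymPoly m ⊗[ℂ] MvPolynomial (Fin n) ℂ →ₗ[ℂ] MvPolynomial (Fin n) ℂ :=
  (TensorProduct.lid ℂ (MvPolynomial (Fin n) ℂ)).toLinearMap ∘ₗ
    LinearMap.rTensor (MvPolynomial (Fin n) ℂ) (evalOne m)

/-- The separating operator `S_n = ρ₀ Q_{z₁} ⋯ Q_{z_n} : ℂ[x]^{S_n} → ℂ[z₁, …, z_n]`. -/
def sepOp {n : ℕ} (Q : SymPoly n →ₗ[ℂ] SymPoly n ⊗[ℂ] ℂ[X]) : SymPoly n →ₗ[ℂ] MvPolynomial (Fin n) ℂ :=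
  evalOneZ n n ∘ₗ
    (List.ofFn fun j : Fin n =>
      (atVar j Q : Module.End ℂ (SymPoly n ⊗[ℂ] MvPolynomial (Fin n) ℂ))).prod ∘ₗ
    (TensorProduct.mk ℂ (SymPoly n) (MvPolynomial (Fin n) ℂ)).flip 1

/-- The composition `A₁ A₂ ⋯ A_m` acting from `ℂ[x₁, …, x_m]^{S_m} ⊗ ℂ[z₁, …, z_n]` to
`ℂ[x₁, …, x_0]^{S_0} ⊗ ℂ[z₁, …, z_n]`. -/
def chain {n : ℕ} (A : AFamily n) : (m : ℕ) → m ≤ n →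
    (SymPoly m ⊗[ℂ] MvPolynomial (Fin n) ℂ →ₗ[ℂ] SymPoly 0 ⊗[ℂ] MvPolynomial (Fin n) ℂ)
  | 0, _ => LinearMap.id
  | m + 1, h => chain A m (Nat.le_of_succ_le h) ∘ₗ atVar ⟨m, h⟩ (A ⟨m, h⟩)

/-- The product `A₁ A₂ ⋯ A_n : ℂ[x]^{S_n} → ℂ[z₁, …, z_n]`; the symmetric polynomials in no
variables are identified with `ℂ`. -/
def chainOp {n : ℕ} (A : AFamily n) : SymPoly n →ₗ[ℂ] MvPolynomial (Fin n) ℂ :=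
  evalOneZ 0 n ∘ₗ chain A n le_rfl ∘ₗ
    (TensorProduct.mk ℂ (SymPoly n) (MvPolynomial (Fin n) ℂ)).flip 1

/-- The value at `(y, z)` of an element of `ℂ[x₁, …, x_m]^{S_m} ⊗ ℂ[z]`. -/
def valueAt {m : ℕ} (y : Fin m → ℂ) (z : ℂ) : SymPoly m ⊗[ℂ] ℂ[X] →ₗ[ℂ] ℂ :=
  TensorProduct.lift ((LinearMap.mul ℂ ℂ).compl₁₂
    ((MvPolynomial.aeval y).toLinearMap ∘ₗ (SymPoly m).val.toLinearMap)
    (Polynomial.aeval z).toLinearMap)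

/-! ### The integral kernel -/

/-- `HasDeltaIntegral Ω g F I` says that `∫_Ω δ(g(x)) F(x) dx = I`. Here `δ` is the Dirac delta
function: for every `η ∈ C_c^∞(ℝ)` with `∫ η = 1`, the integrals with `δ(s)` replaced by
`ε⁻¹ η(s / ε)` exist for small `ε > 0` and converge to `I` as `ε → 0⁺`. -/
def HasDeltaIntegral {ι : Type} [Fintype ι] (Ω : Set (ι → ℝ)) (g : (ι → ℝ) → ℝ)
    (F : (ι → ℝ) → ℂ) (I : ℂ) : Prop :=
  ∀ η : ℝ → ℝ, ContDiff ℝ ∞ η → HasCompactSupport η → ∫ s, η s = 1 →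
    (∀ᶠ ε in 𝓝[>] (0 : ℝ),
      MeasureTheory.IntegrableOn (fun x => (ε⁻¹ * η (g x / ε)) • F x) Ω) ∧
    Filter.Tendsto (fun ε : ℝ => ∫ x in Ω, (ε⁻¹ * η (g x / ε)) • F x) (𝓝[>] 0) (𝓝 I)

/-- The domain `1 < x₁ < y₁ < x₂ < y₂ < ⋯ < y_m < x_{m+1}`. -/
def interlacing {m : ℕ} (y : Fin m → ℝ) : Set (Fin (m + 1) → ℝ) :=
  {x | 1 < x 0 ∧ ∀ i : Fin m, x i.castSucc < y i ∧ y i < x i.succ}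

/-- With `k = m + 1`, the constant
`(-1)^{k-1} (n-1)! / ((n-k)! (z-1)^{n-1} Δ_{k-1}(y) ∏_{j=1}^{k-1} (y_j - 1)^{n-k+1})`. -/
def kernelConst (n m : ℕ) (z : ℝ) (y : Fin m → ℝ) : ℝ :=
  (-1) ^ m * (n - 1).factorial /
    ((n - (m + 1)).factorial * (z - 1) ^ (n - 1) * vdm y * ∏ i, (y i - 1) ^ (n - m))

/-- With `k = m + 1`, the factor `Δ_k(x) ∏_{j=1}^k (x_j - 1)^{n-k} f(x)`. -/
def kernelFun (n m : ℕ) (f : SymPoly (m + 1)) (x : Fin (m + 1) → ℝ) : ℂ :=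
  ((vdm x * ∏ i, (x i - 1) ^ (n - (m + 1)) : ℝ) : ℂ) *
    MvPolynomial.aeval (fun i => (x i : ℂ)) (f : MvPolynomial (Fin (m + 1)) ℂ)

end

end SchurSep

open SchurSep

/-! Fix `λ` with exponents `μ_j = λ_j + n - j`. When `n - k` of the variables tend to `1`, the
quotient `a_{λ+δ} / a_δ` becomes `c(x) / (Δ_k(x) ∏ (x_i - 1)^{n-k})` up to a constant independent of
`λ`. Here `c(x)` is the confluent alternant, with rows `x_i ^ μ_j` followed by rows `μ_j ^ r`
(`schur_padOne`). On `s̄_λ` the integral formula therefore reduces to `∫ δ(∏ x - z ∏ y) c(x) dx =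
c(y) c(z) / c(∅)`, integrated over the interlacing domain.

This identity is checked on negative moments in the product `∏ x`. For fixed `y` the domain is a
box, so the integral of the determinant is taken row by row. It produces differences of consecutive
`y_i ^ (μ_j - s)`, each divided by `s - μ_j`, and row operations turn these back into `c(y)`
(`moment_confluent`). The case without `y` (`moment_confluent_one`) gives the moments of `c(t)` on
`t > 1`, and the two agree up to the factor `(∏ y)^{-s} c(y) / c(∅)`. By Weierstrass approximation,
`c(x) dx` pushed forward along `∏ x` is then a multiple of `c(t) dt` pushed forward along `t ∏ y`,
and an approximate identity in one variable yields the delta integral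
(`hasDeltaIntegral_confluent`).

The `s̄_λ` form a basis, which defines `Q` and extends the formula by linearity to `ρ_{k-1} Q F` for
every symmetric `F` (`hasDeltaIntegral_kernelFun`). Its right side depends only on `ρ_k F`, so `ρ_k
F = 0` forces `ρ_{k-1} Q F = 0`. As `ρ_k` is surjective, `A_k` exists and is unique. The
factorization holds because both sides send `s̄_λ` to `∏ q_λ(z_j)`. -/

namespace SchurSep

/-! ### Confluent alternants -/

section Confluent

variable {R : Type*} [CommRing R]

/-- The matrix with arbitrary rows `u i` for `i < k`, followed by the rows `w ^ 0, w ^ 1, …`. -/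
def rowMatrix {n k : ℕ} (u : Fin k → Fin n → R) (w : Fin n → R) : Matrix (Fin n) (Fin n) R :=
  Matrix.of fun i j => if h : (i : ℕ) < k then u ⟨i, h⟩ j else w j ^ ((i : ℕ) - k)

/-- The determinant of `rowMatrix`. -/
def rowDet {n k : ℕ} (u : Fin k → Fin n → R) (w : Fin n → R) : R := (rowMatrix u w).det

/-- The confluent alternant: rows `x_i ^ μ_j` for `i < k`, followed by the rows `μ_j ^ r` for
`r < n - k`. -/
def confluent {n k : ℕ} (mu : Fin n → ℕ) (x : Fin k → R) : R :=
  rowDet (fun i j => x i ^ mu j) fun j => (mu j : R)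

theorem map_confluent {S : Type*} [CommRing S] (φ : R →+* S) {n k : ℕ} (mu : Fin n → ℕ)
    (x : Fin k → R) : φ (confluent mu x) = confluent mu fun i => φ (x i) := by
  simp only [confluent, rowDet, RingHom.map_det]
  congr 1
  ext i j
  by_cases h : (i : ℕ) < k <;> simp [rowMatrix, h]

theorem prod_fin_split {M : Type*} [CommMonoid M] {n k : ℕ} (hk : k ≤ n) (f : Fin k → M)
    (g : ℕ → M) :
    ∏ i : Fin n, (if h : (i : ℕ) < k then f ⟨i, h⟩ else g ((i : ℕ) - k)) =
      (∏ i, f i) * ∏ r : Fin (n - k), g r := by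
  obtain ⟨m, rfl⟩ := Nat.exists_eq_add_of_le hk
  rw [Fin.prod_univ_add]
  congr 1
  · simp
  · rw [show k + m - k = m by omega]
    simp

/-- By the binomial theorem the powers of `c w + 1` arise from those of `w` through a lower
triangular matrix with diagonal `c ^ r`; the rows `u` are untouched. -/
theorem rowDet_affine {n k : ℕ} (hk : k ≤ n) (u : Fin k → Fin n → R) (w : Fin n → R) (c : R) :
    rowDet u (fun j => c * w j + 1) = (∏ r : Fin (n - k), c ^ (r : ℕ)) * rowDet u w := by
  obtain ⟨m, rfl⟩ := Nat.exists_eq_add_of_le hk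
  let T : Matrix (Fin (k + m)) (Fin (k + m)) R := Matrix.of fun i i' =>
    if (i : ℕ) < k then (if i = i' then 1 else 0) else
      if (i' : ℕ) < k then 0 else (((i : ℕ) - k).choose ((i' : ℕ) - k) : R) * c ^ ((i' : ℕ) - k)
  have hT : T.det = ∏ r : Fin (k + m - k), c ^ (r : ℕ) := by
    rw [Matrix.det_of_isLowerTriangular T]
    · have h := prod_fin_split (M := R) hk (fun _ => 1) (fun r => c ^ r)
      rw [Finset.prod_const_one, one_mul] at h
      rw [← h]
      refine Finset.prod_congr rfl fun i _ => ?_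
      by_cases h : (i : ℕ) < k <;> simp [T, h]
    · intro i i' h
      have h : i < i' := h
      have h' : (i : ℕ) < i' := h
      simp only [T, Matrix.of_apply]
      split_ifs with h1 h2 h3
      · exact absurd h2 h.ne
      · rfl
      · rfl
      · rw [Nat.choose_eq_zero_of_lt (by omega)]; simp
  rw [← hT, rowDet, rowDet, ← Matrix.det_mul]
  congr 1
  ext i j
  rw [Matrix.mul_apply]
  by_cases h : (i : ℕ) < k
  · simp only [T, Matrix.of_apply, h, if_true, ite_mul, one_mul, zero_mul, Finset.sum_ite_eq,
      Finset.mem_univ]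
    simp [rowMatrix, h]
  · rw [Fin.sum_univ_add]
    simp only [rowMatrix, Matrix.of_apply, h, T, Fin.val_castAdd, Fin.is_lt, Fin.val_natAdd]
    simp only [if_true, if_false, dite_false, zero_mul, Finset.sum_const_zero, zero_add,
      add_lt_iff_neg_left, not_lt_zero, add_tsub_cancel_left]
    rw [add_pow, Finset.sum_fin_eq_sum_range, ← Finset.sum_subset
      (Finset.range_subset_range.2 (show (i : ℕ) - k + 1 ≤ m by have := i.2; omega))]
    · refine Finset.sum_congr rfl fun r hr => ?_
      have : r < m := by have := i.2; have := Finset.mem_range.1 hr; omega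
      simp [this, mul_pow]
      ring
    · intro r _ hr
      rw [Finset.mem_range, not_lt] at hr
      split_ifs with h1
      · rw [Nat.choose_eq_zero_of_lt (show (i : ℕ) - k < r by omega)]; simp
      · rfl

theorem vdm_add {k m : ℕ} (x : Fin (k + m) → R) :
    vdm x = vdm (fun i => x (Fin.castAdd m i)) *
      (∏ i, ∏ j, (x (Fin.castAdd m i) - x (Fin.natAdd k j))) *
      vdm (fun i => x (Fin.natAdd k i)) := by
  have h : ∀ {l : ℕ} (y : Fin l → R), vdm y = ∏ i, ∏ j, if i < j then y i - y j else 1 := by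
    intro l y
    refine Finset.prod_congr rfl fun i _ => ?_
    rw [← Finset.prod_filter]
    refine Finset.prod_congr ?_ fun _ _ => rfl
    ext; simp
  rw [h, h, h, Fin.prod_univ_add]
  simp only [Fin.prod_univ_add, Finset.prod_mul_distrib]
  have h1 : ∀ (i : Fin k) (j : Fin m), Fin.castAdd m i < Fin.natAdd k j := fun i j => by
    simp only [Fin.lt_def, Fin.val_castAdd, Fin.val_natAdd]; omega
  have h2 : ∀ i j : Fin m, Fin.natAdd k i < Fin.natAdd k j ↔ i < j := fun i j => by
    simp only [Fin.lt_def, Fin.val_natAdd]; omega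
  have h3 : ∀ i j : Fin k, Fin.castAdd m i < Fin.castAdd m j ↔ i < j := fun i j => Iff.rfl
  simp only [h1, h2, h3, (h1 _ _).not_gt, if_true, if_false, Finset.prod_const_one, one_mul]

theorem vdm_smul_add {m : ℕ} (x : Fin m → R) (c d : R) :
    vdm (fun i => c * x i + d) = (∏ r : Fin m, c ^ (r : ℕ)) * vdm x := by
  simp only [vdm, add_sub_add_right_eq_sub, ← mul_sub, Finset.prod_mul_distrib,
    Finset.prod_const, Fin.card_Ioi]
  congr 1
  rw [← Equiv.prod_comp Fin.revPerm]
  refine Finset.prod_congr rfl fun i _ => ?_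
  congr 1
  simp [Fin.val_rev]
  omega

/-- The node `0` contributes `(-1)^m m!` and the remaining nodes are a translate of `0, …, m - 1`.
This recursion is the source of the sign and the factorials in `kernelConst`. -/
theorem vdm_natCast_succ (m : ℕ) :
    vdm (fun i : Fin (m + 1) => (i : R)) =
      (-1) ^ m * (m.factorial : R) * vdm (fun i : Fin m => (i : R)) := by
  have h0 : vdm (fun i : Fin (m + 1) => (i : R)) =
      (∏ j : Fin m, ((0 : R) - ((j : ℕ) + 1 : ℕ))) * vdm (fun i : Fin m => (i : R) + 1) := by
    rw [vdm, vdm, Fin.prod_univ_succ]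
    congr 1
    · rw [Fin.Ioi_zero_eq_map, Finset.prod_map]
      simp
    · refine Finset.prod_congr rfl fun i _ => ?_
      rw [Fin.Ioi_succ, Finset.prod_map]
      simp
  rw [h0]
  have h1 := vdm_smul_add (fun i : Fin m => (i : R)) 1 1
  simp only [one_mul, one_pow, Finset.prod_const_one] at h1
  rw [h1]
  congr 1
  simp only [zero_sub]
  rw [Finset.prod_neg, ← Finset.prod_range_add_one_eq_factorial, Nat.cast_prod,
    Fin.prod_univ_eq_prod_range (fun j => ((j + 1 : ℕ) : R)) m]
  simp

theorem vdm_ne_zero [IsDomain R] {m : ℕ} {x : Fin m → R} (hx : Function.Injective x) :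
    vdm x ≠ 0 := by
  refine Finset.prod_ne_zero_iff.2 fun i _ => Finset.prod_ne_zero_iff.2 fun j hj => ?_
  exact sub_ne_zero.2 fun h => (Finset.mem_Ioi.1 hj).ne (hx h)

end Confluent

/-- The exponents `λ_j + n - 1 - j`. -/
def shifted {n : ℕ} (lam : Fin n → ℕ) (j : Fin n) : ℕ := lam j + (n - 1 - (j : ℕ))

theorem shifted_strictAnti {n : ℕ} {lam : Fin n → ℕ} (h : Antitone lam) :
    StrictAnti (shifted lam) := by
  intro i j hij
  have h1 := h hij.le
  have h2 : (i : ℕ) < j := hij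
  have := j.2
  simp only [shifted]
  omega

/-- `x₁, …, x_k, 1, …, 1`. -/
def padOne {R : Type*} [One R] (n : ℕ) {k : ℕ} (x : Fin k → R) (i : Fin n) : R :=
  if h : (i : ℕ) < k then x ⟨i, h⟩ else 1

/-! ### Schur polynomials at points padded with ones -/

theorem aeval_alternant {n : ℕ} (lam : Fin n → ℕ) (x : Fin n → ℂ) :
    MvPolynomial.aeval x (alternant lam) =
      (Matrix.of fun i j => x i ^ shifted lam j).det := by
  rw [alternant, AlgHom.map_det]
  congr 1
  ext i j
  simp [shifted]

theorem aeval_vdm {n : ℕ} (x : Fin n → ℂ) :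
    MvPolynomial.aeval x (vdm (MvPolynomial.X : Fin n → MvPolynomial (Fin n) ℂ)) = vdm x := by
  simp [vdm, map_prod]

/-- The ones are deformed to `1, q, q², …`. Both alternants then carry the same factor `∏ (q -
1)^r`, which cancels for `q ≠ 1`; the rest is continuous in `q` and is evaluated at `q = 1`. -/
theorem schur_padOne {n k : ℕ} (hk : k ≤ n) (lam : Fin n → ℕ) (x : Fin k → ℂ) :
    MvPolynomial.aeval (padOne n x) (schur lam : MvPolynomial (Fin n) ℂ) *
      (vdm x * (∏ i, (x i - 1) ^ (n - k)) * vdm (fun i : Fin (n - k) => (i : ℂ))) =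
      confluent (shifted lam) x := by
  let X : ℂ → Fin n → ℂ := fun q i => if h : (i : ℕ) < k then x ⟨i, h⟩ else q ^ ((i : ℕ) - k)
  let f : ℂ → ℂ := fun q => MvPolynomial.aeval (X q) (schur lam : MvPolynomial (Fin n) ℂ) *
    (vdm x * (∏ i, ∏ r : Fin (n - k), (x i - q ^ (r : ℕ))) *
      vdm (fun i : Fin (n - k) => ∑ a ∈ Finset.range i, q ^ a))
  let g : ℂ → ℂ := fun q => rowDet (fun i j => x i ^ shifted lam j)
    (fun j => ∑ a ∈ Finset.range (shifted lam j), q ^ a)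
  have hX : Continuous X := by
    refine continuous_pi fun i => ?_
    by_cases h : (i : ℕ) < k <;> simp only [X, h, dite_true, dite_false] <;> fun_prop
  have hf : Continuous f := by
    refine Continuous.mul ?_ ?_
    · have : ∀ p : MvPolynomial (Fin n) ℂ, Continuous fun q => MvPolynomial.aeval (X q) p := by
        intro p
        simp only [MvPolynomial.aeval_eq_eval]
        exact (MvPolynomial.continuous_eval p).comp hX
      exact this _
    · simp only [vdm]
      fun_prop
  have hg : Continuous g := by
    refine Continuous.matrix_det ?_
    refine continuous_matrix fun i j => ?_
    by_cases h : (i : ℕ) < k <;> simp only [rowMatrix, Matrix.of_apply, h, dite_true, dite_false] <;>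
      fun_prop
  have hfg : Set.EqOn f g {1}ᶜ := by
    intro q hq
    have hq' : q - 1 ≠ 0 := sub_ne_zero.2 hq
    have hgeom : ∀ a : ℕ, q ^ a = (q - 1) * (∑ i ∈ Finset.range a, q ^ i) + 1 := by
      intro a
      rw [mul_geom_sum]
      ring
    have h0 := congrArg (MvPolynomial.aeval (X q)) (schur_spec lam)
    rw [map_mul, alternant_zero, aeval_vdm, aeval_alternant] at h0
    -- The row of `q ^ r` has entries `(q ^ μ_j) ^ r = ((q - 1) [μ_j]_q + 1) ^ r`, so
    -- `rowDet_affine` applies with `c = q - 1`.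
    have h1 : (Matrix.of fun i j => X q i ^ shifted lam j).det =
        (∏ r : Fin (n - k), (q - 1) ^ (r : ℕ)) * g q := by
      rw [← rowDet_affine hk, rowDet]
      congr 1
      ext i j
      by_cases h : (i : ℕ) < k
      · simp [rowMatrix, h, X]
      · simp only [rowMatrix, h, X, Matrix.of_apply, dite_false]
        rw [← hgeom, ← pow_mul, ← pow_mul, mul_comm]
    have h2 : vdm (X q) = vdm x * (∏ i, ∏ r : Fin (n - k), (x i - q ^ (r : ℕ))) *
        ((∏ r : Fin (n - k), (q - 1) ^ (r : ℕ)) *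
          vdm (fun i : Fin (n - k) => ∑ a ∈ Finset.range i, q ^ a)) := by
      have h3 : vdm (fun i : Fin (n - k) => q ^ (i : ℕ)) = (∏ r : Fin (n - k), (q - 1) ^ (r : ℕ)) *
          vdm (fun i : Fin (n - k) => ∑ a ∈ Finset.range i, q ^ a) := by
        rw [← vdm_smul_add _ _ 1]
        simp only [← hgeom]
      rw [← h3]
      obtain ⟨m, rfl⟩ := Nat.exists_eq_add_of_le hk
      rw [vdm_add]
      simp only [X, Fin.val_castAdd, Fin.is_lt, dite_true, Fin.eta, Fin.val_natAdd,
        add_lt_iff_neg_left, not_lt_zero, dite_false, add_tsub_cancel_left]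
      rw [show k + m - k = m by omega]
    have h3 : (∏ r : Fin (n - k), (q - 1) ^ (r : ℕ)) ≠ 0 :=
      Finset.prod_ne_zero_iff.2 fun _ _ => pow_ne_zero _ hq'
    refine mul_left_cancel₀ h3 ?_
    rw [← h1, ← h0, h2]
    simp only [f]
    ring
  have := congrFun (Continuous.ext_on (dense_compl_singleton (1 : ℂ)) hf hg hfg) 1
  have hp : padOne n x = X 1 := by ext i; simp [padOne, X]
  rw [hp]
  simpa [f, g, confluent, Finset.prod_const] using this

theorem vdm_natCast_ne_zero (m : ℕ) : vdm (fun i : Fin m => (i : ℂ)) ≠ 0 :=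
  vdm_ne_zero fun i j h => Fin.ext (by exact_mod_cast h)

theorem evalOne_schur {n : ℕ} (lam : Fin n → ℕ) (x : Fin 0 → ℂ) :
    evalOne n (schur lam) * vdm (fun i : Fin n => (i : ℂ)) = confluent (shifted lam) x := by
  have h := schur_padOne (Nat.zero_le n) lam x
  have hx : vdm x = 1 := by simp [vdm]
  have hp : padOne n x = fun _ => 1 := by ext i; simp [padOne]
  rw [hp] at h
  simpa [hx, evalOne] using h

/-- With no `x`-rows this is the transposed Vandermonde determinant of the exponents. -/
theorem confluent_zero_ne_zero {n : ℕ} {mu : Fin n → ℕ} (h : Function.Injective mu)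
    (x : Fin 0 → ℂ) : confluent mu x ≠ 0 := by
  have : confluent mu x = (Matrix.vandermonde fun j => (mu j : ℂ)).det := by
    rw [confluent, rowDet, ← Matrix.det_transpose]
    simp [rowMatrix, Matrix.vandermonde, Matrix.transpose]
  rw [this, Matrix.det_vandermonde_ne_zero_iff]
  exact Nat.cast_injective.comp h

theorem evalOne_schur_ne_zero {n : ℕ} {lam : Fin n → ℕ} (h : Antitone lam) :
    evalOne n (schur lam) ≠ 0 := fun h0 =>
  confluent_zero_ne_zero (shifted_strictAnti h).injective Fin.elim0 <| by
    rw [← evalOne_schur, h0, zero_mul]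

theorem evalOne_schurBar {n : ℕ} {lam : Fin n → ℕ} (h : Antitone lam) :
    evalOne n (schurBar lam) = 1 := by
  rw [schurBar, map_smul, smul_eq_mul, inv_mul_cancel₀ (evalOne_schur_ne_zero h)]

/-- The case `k = 0` of `schur_padOne` supplies the normalization, so all dependence on `λ` sits in
a ratio of two confluent alternants. -/
theorem schurBar_padOne {n k : ℕ} (hk : k ≤ n) {lam : Fin n → ℕ} (h : Antitone lam)
    (x : Fin k → ℂ) (x₀ : Fin 0 → ℂ) :
    MvPolynomial.aeval (padOne n x) (schurBar lam : MvPolynomial (Fin n) ℂ) *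
      (vdm x * (∏ i, (x i - 1) ^ (n - k))) =
      vdm (fun i : Fin n => (i : ℂ)) / vdm (fun i : Fin (n - k) => (i : ℂ)) /
        confluent (shifted lam) x₀ * confluent (shifted lam) x := by
  rw [← schur_padOne hk, ← evalOne_schur, schurBar]
  have h1 := evalOne_schur_ne_zero h
  have h2 := vdm_natCast_ne_zero n
  have h3 := vdm_natCast_ne_zero (n - k)
  simp only [SetLike.val_smul, map_smul, smul_eq_mul]
  field_simp

/-! ### The Schur basis -/

/-- The exponent vector `e` as a finitely supported function. -/
noncomputable def expo {n : ℕ} (e : Fin n → ℕ) : Fin n →₀ ℕ := Finsupp.equivFunOnFinite.symm e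

theorem prod_X_pow {n : ℕ} (e : Fin n → ℕ) :
    ∏ i, (MvPolynomial.X i : MvPolynomial (Fin n) ℂ) ^ e i = MvPolynomial.monomial (expo e) 1 := by
  rw [MvPolynomial.monomial_eq, Finsupp.prod_fintype _ _ (fun _ => pow_zero _)]
  simp [expo]

/-- The alternant with arbitrary exponents. -/
noncomputable def rawAlternant {n : ℕ} (nu : Fin n → ℕ) : MvPolynomial (Fin n) ℂ :=
  (Matrix.of fun i j : Fin n => (MvPolynomial.X i : MvPolynomial (Fin n) ℂ) ^ nu j).det

theorem alternant_eq_rawAlternant {n : ℕ} (lam : Fin n → ℕ) :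
    alternant lam = rawAlternant (shifted lam) := rfl

theorem rawAlternant_eq_sum {n : ℕ} (nu : Fin n → ℕ) :
    rawAlternant nu = ∑ σ : Equiv.Perm (Fin n),
      (Equiv.Perm.sign σ : ℤ) • MvPolynomial.monomial (expo (nu ∘ σ)) (1 : ℂ) := by
  rw [rawAlternant, ← Matrix.det_transpose, Matrix.det_apply]
  refine Finset.sum_congr rfl fun σ _ => ?_
  rw [← prod_X_pow]
  rfl

/-- A permutation carrying one strictly decreasing exponent vector to another is increasing, hence
trivial; only the diagonal term contributes. -/
theorem coeff_alternant {n : ℕ} {lam kap : Fin n → ℕ} (hl : Antitone lam) (hk : Antitone kap) :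
    MvPolynomial.coeff (expo (shifted kap)) (alternant lam) = if lam = kap then 1 else 0 := by
  rw [alternant_eq_rawAlternant, rawAlternant_eq_sum, MvPolynomial.coeff_sum,
    Finset.sum_eq_single 1]
  · have : expo (shifted lam) = expo (shifted kap) ↔ lam = kap := by
      rw [expo, expo, Equiv.apply_eq_iff_eq, funext_iff, funext_iff]
      simp [shifted]
    simp [MvPolynomial.coeff_monomial, this]
  · intro σ _ hσ
    rw [MvPolynomial.coeff_smul, MvPolynomial.coeff_monomial, if_neg, smul_zero]
    intro h
    rw [expo, expo, Equiv.apply_eq_iff_eq] at h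
    refine hσ (Equiv.ext fun i => ?_)
    have hmono : StrictMono σ := by
      intro a b hab
      have h1 := shifted_strictAnti hk hab
      rw [← h] at h1
      exact (shifted_strictAnti hl).lt_iff_gt.1 h1
    exact congrFun (congrArg DFunLike.coe
      (Subsingleton.elim (hmono.orderIsoOfSurjective _ σ.surjective) (OrderIso.refl _))) i
  · simp

/-- Repeated exponents give equal columns and determinant zero. Distinct ones can be sorted
decreasingly at the cost of a sign, and subtracting the staircase then leaves a partition. -/
theorem rawAlternant_mem_span {n : ℕ} (nu : Fin n → ℕ) :
    rawAlternant nu ∈ Submodule.span ℂ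
      (Set.range fun lam : {lam : Fin n → ℕ // Antitone lam} => alternant lam.1) := by
  classical
  by_cases hinj : Function.Injective nu
  · let σ : Equiv.Perm (Fin n) := Fin.revPerm.trans (Tuple.sort nu)
    have hσ : StrictAnti (nu ∘ σ) := by
      have h1 : StrictMono (nu ∘ Tuple.sort nu) :=
        (Tuple.monotone_sort nu).strictMono_of_injective (hinj.comp (Tuple.sort nu).injective)
      exact h1.comp_strictAnti fun a b hab => Fin.rev_lt_rev.2 hab
    have hdet : rawAlternant (nu ∘ σ) = (Equiv.Perm.sign σ : ℤ) • rawAlternant nu := by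
      have := Matrix.det_permute' σ (Matrix.of fun i j : Fin n =>
        (MvPolynomial.X i : MvPolynomial (Fin n) ℂ) ^ nu j)
      rw [zsmul_eq_mul, rawAlternant, rawAlternant, ← this]
      rfl
    -- This bound ensures that the natural subtraction of the staircase does not truncate.
    have hbound : ∀ (d : ℕ) (j : Fin n), n - 1 - (j : ℕ) = d → d ≤ (nu ∘ σ) j := by
      intro d
      induction d with
      | zero => simp
      | succ d ih =>
        intro j hj
        have h1 := ih ⟨j + 1, by omega⟩ (by simp only; omega)
        have h2 : (nu ∘ σ) ⟨j + 1, by omega⟩ < (nu ∘ σ) j := hσ (by simp [Fin.lt_def])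
        omega
    have hanti : Antitone fun j : Fin n => (nu ∘ σ) j - (n - 1 - (j : ℕ)) := by
      have key : ∀ (d : ℕ) (i j : Fin n), (j : ℕ) = i + d →
          (nu ∘ σ) j + d ≤ (nu ∘ σ) i := by
        intro d
        induction d with
        | zero => intro i j h; rw [Fin.ext (h.trans (Nat.add_zero _))]; simp
        | succ d ih =>
          intro i j h
          have h1 := ih i ⟨i + d, by omega⟩ rfl
          have h2 : (nu ∘ σ) j < (nu ∘ σ) ⟨i + d, by omega⟩ := hσ (by simp [Fin.lt_def]; omega)
          omega
      intro i j hij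
      have h1 := key (j - i) i j (by have : (i : ℕ) ≤ j := hij; omega)
      have h2 : (i : ℕ) ≤ j := hij
      have := j.2
      simp only
      omega
    have hmem : rawAlternant (nu ∘ σ) ∈ Submodule.span ℂ
        (Set.range fun lam : {lam : Fin n → ℕ // Antitone lam} => alternant lam.1) := by
      refine Submodule.subset_span ⟨⟨_, hanti⟩, ?_⟩
      change rawAlternant (shifted fun j : Fin n => (nu ∘ σ) j - (n - 1 - (j : ℕ))) = _
      congr 1
      funext j
      have := hbound _ j rfl
      simp only [shifted]
      omega
    rw [hdet] at hmem
    rcases Int.units_eq_one_or (Equiv.Perm.sign σ) with h | h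
    · simpa [h] using hmem
    · simpa [h] using hmem
  · rw [Function.not_injective_iff] at hinj
    obtain ⟨a, b, hab, hne⟩ := hinj
    have : rawAlternant nu = 0 := by
      refine Matrix.det_zero_of_column_eq hne fun i => ?_
      simp [hab]
    rw [this]
    exact zero_mem _

/-- Antisymmetrizing a monomial gives a multiple of an alternant, while antisymmetrizing `g` gives
`n! g`. -/
theorem antisymm_mem_span {n : ℕ} (g : MvPolynomial (Fin n) ℂ)
    (hg : ∀ σ : Equiv.Perm (Fin n),
      MvPolynomial.rename σ g = (Equiv.Perm.sign σ : ℤ) • g) :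
    g ∈ Submodule.span ℂ
      (Set.range fun lam : {lam : Fin n → ℕ // Antitone lam} => alternant lam.1) := by
  have hrename : ∀ p : MvPolynomial (Fin n) ℂ,
      ∑ σ : Equiv.Perm (Fin n), (Equiv.Perm.sign σ : ℤ) • MvPolynomial.rename σ p ∈
      Submodule.span ℂ
        (Set.range fun lam : {lam : Fin n → ℕ // Antitone lam} => alternant lam.1) := by
    intro p
    induction p using MvPolynomial.induction_on' with
    | monomial e a =>
      have h : ∑ σ : Equiv.Perm (Fin n), (Equiv.Perm.sign σ : ℤ) •
          MvPolynomial.rename σ (MvPolynomial.monomial e a) = a • rawAlternant e := by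
        -- Renaming variables by `σ` moves exponents by `σ⁻¹`, hence the reindexing by inversion.
        rw [rawAlternant_eq_sum, ← Equiv.sum_comp (Equiv.inv (Equiv.Perm (Fin n))),
          Finset.smul_sum]
        refine Finset.sum_congr rfl fun σ _ => ?_
        have hm : Finsupp.mapDomain (σ⁻¹ : Equiv.Perm (Fin n)) e = expo (e ∘ σ) := by
          ext i
          have := Finsupp.mapDomain_apply (σ⁻¹ : Equiv.Perm (Fin n)).injective e (σ i)
          rwa [← Equiv.Perm.mul_apply, inv_mul_cancel, Equiv.Perm.one_apply] at this
        have ha : MvPolynomial.monomial (expo (e ∘ σ)) a =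
            a • MvPolynomial.monomial (expo (e ∘ σ)) (1 : ℂ) := by
          rw [MvPolynomial.smul_monomial, smul_eq_mul, mul_one]
        rw [Equiv.inv_apply, Equiv.Perm.sign_inv, MvPolynomial.rename_monomial, hm, ha,
          smul_comm]
      rw [h]
      exact Submodule.smul_mem _ _ (rawAlternant_mem_span _)
    | add p q hp hq =>
      simp only [map_add, smul_add, Finset.sum_add_distrib]
      exact add_mem hp hq
  have h := hrename g
  have h1 : ∑ σ : Equiv.Perm (Fin n), (Equiv.Perm.sign σ : ℤ) • MvPolynomial.rename σ g =
      (n.factorial : ℂ) • g := by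
    have : ∀ σ : Equiv.Perm (Fin n), (Equiv.Perm.sign σ : ℤ) • MvPolynomial.rename σ g = g := by
      intro σ
      rw [hg, smul_smul, ← Units.val_mul, Int.units_mul_self, Units.val_one, one_smul]
    simp only [this, Finset.sum_const, Finset.card_univ, Fintype.card_perm, Fintype.card_fin]
    rw [Nat.cast_smul_eq_nsmul]
  rw [h1] at h
  exact (Submodule.smul_mem_iff _ (Nat.cast_ne_zero.2 (Nat.factorial_ne_zero n))).1 h

/-- Multiplication by `a_δ` on symmetric polynomials. -/
noncomputable def mulDelta (n : ℕ) : SymPoly n →ₗ[ℂ] MvPolynomial (Fin n) ℂ :=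
  LinearMap.mulLeft ℂ (alternant (0 : Fin n → ℕ)) ∘ₗ (SymPoly n).val.toLinearMap

theorem mulDelta_schur {n : ℕ} (lam : Fin n → ℕ) : mulDelta n (schur lam) = alternant lam :=
  schur_spec lam

theorem mulDelta_injective (n : ℕ) : Function.Injective (mulDelta n) := fun _ _ h =>
  Subtype.ext (mul_left_cancel₀ (alternant_zero_ne_zero n) h)

/-- Multiplication by `a_δ` embeds the symmetric polynomials in the antisymmetric ones and takes
Schur functions to alternants, which span there. -/
theorem span_schurBar (n : ℕ) :
    Submodule.span ℂ (Set.range fun lam : {lam : Fin n → ℕ // Antitone lam} =>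
      schurBar lam.1) = ⊤ := by
  refine eq_top_iff.2 fun f _ => ?_
  have h : mulDelta n f ∈ Submodule.span ℂ
      (Set.range fun lam : {lam : Fin n → ℕ // Antitone lam} => alternant lam.1) := by
    refine antisymm_mem_span _ fun σ => ?_
    have hf : MvPolynomial.rename σ (f : MvPolynomial (Fin n) ℂ) = f := f.2 σ
    change MvPolynomial.rename σ (alternant 0 * (f : MvPolynomial (Fin n) ℂ)) =
      (Equiv.Perm.sign σ : ℤ) • (alternant 0 * (f : MvPolynomial (Fin n) ℂ))
    rw [map_mul, rename_alternant, hf, smul_mul_assoc]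
  have h2 : Submodule.span ℂ
      (Set.range fun lam : {lam : Fin n → ℕ // Antitone lam} => alternant lam.1) ≤
      (Submodule.span ℂ (Set.range fun lam : {lam : Fin n → ℕ // Antitone lam} =>
      schurBar lam.1)).map (mulDelta n) := by
    refine Submodule.span_le.2 ?_
    rintro _ ⟨lam, rfl⟩
    refine ⟨evalOne n (schur lam.1) • schurBar lam.1,
      Submodule.smul_mem _ _ (Submodule.subset_span ⟨lam, rfl⟩), ?_⟩
    rw [schurBar, smul_smul, mul_inv_cancel₀ (evalOne_schur_ne_zero lam.2), one_smul,
      mulDelta_schur]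
  obtain ⟨g, hg, hgf⟩ := h2 h
  rwa [← mulDelta_injective n hgf]

theorem linearIndependent_schurBar (n : ℕ) :
    LinearIndependent ℂ fun lam : {lam : Fin n → ℕ // Antitone lam} => schurBar lam.1 := by
  rw [linearIndependent_iff']
  intro s c hc kap hkap
  have h := congrArg (fun f => MvPolynomial.coeff (expo (shifted kap.1)) (mulDelta n f)) hc
  simp only [map_sum, map_smul, schurBar, mulDelta_schur, MvPolynomial.coeff_sum,
    MvPolynomial.coeff_smul, map_zero, MvPolynomial.coeff_zero] at h
  rw [Finset.sum_eq_single kap] at h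
  · rw [coeff_alternant kap.2 kap.2, if_pos rfl, smul_eq_mul, smul_eq_mul, mul_one] at h
    exact (mul_eq_zero.1 h).resolve_right (inv_ne_zero (evalOne_schur_ne_zero kap.2))
  · intro lam _ hne
    rw [coeff_alternant lam.2 kap.2, if_neg fun h => hne (Subtype.ext h), smul_zero, smul_zero]
  · exact fun h => absurd hkap h

/-- The basis of normalized Schur functions. -/
noncomputable def schurBasis (n : ℕ) : Module.Basis {lam : Fin n → ℕ // Antitone lam} ℂ (SymPoly n) :=
  Module.Basis.mk (linearIndependent_schurBar n) (span_schurBar n).ge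

theorem schurBasis_apply {n : ℕ} (lam : {lam : Fin n → ℕ // Antitone lam}) :
    schurBasis n lam = schurBar lam.1 := by
  simp [schurBasis]

theorem ext_schurBar {n : ℕ} {V : Type*} [AddCommMonoid V] [Module ℂ V] {S T : SymPoly n →ₗ[ℂ] V}
    (h : ∀ lam : Fin n → ℕ, Antitone lam → S (schurBar lam) = T (schurBar lam)) : S = T :=
  (schurBasis n).ext fun lam => by rw [schurBasis_apply]; exact h _ lam.2

theorem existsUnique_isQOperator (n : ℕ) :
    ∃! Q : SymPoly n →ₗ[ℂ] SymPoly n ⊗[ℂ] ℂ[X], IsQOperator n Q := by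
  refine ⟨(schurBasis n).constr ℂ fun lam => schurBar lam.1 ⊗ₜ[ℂ] qPoly lam.1,
    fun lam hlam => ?_, fun Q hQ => ext_schurBar (n := n) fun lam hlam => ?_⟩
  · have := (schurBasis n).constr_basis ℂ
      (fun lam => schurBar lam.1 ⊗ₜ[ℂ] qPoly lam.1) ⟨lam, hlam⟩
    rwa [schurBasis_apply] at this
  · have := (schurBasis n).constr_basis ℂ
      (fun lam => schurBar lam.1 ⊗ₜ[ℂ] qPoly lam.1) ⟨lam, hlam⟩
    rw [schurBasis_apply] at this
    rw [this, hQ lam hlam]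

/-! ### Operators acting on a tensor factor -/

theorem atVar_tmul {n : ℕ} (j : Fin n) {M N : Type} [AddCommGroup M] [Module ℂ M]
    [AddCommGroup N] [Module ℂ N] (T : M →ₗ[ℂ] N ⊗[ℂ] ℂ[X]) {x : M} {y : N} {q : ℂ[X]}
    (h : T x = y ⊗ₜ[ℂ] q) (p : MvPolynomial (Fin n) ℂ) :
    atVar j T (x ⊗ₜ[ℂ] p) =
      y ⊗ₜ[ℂ] (Polynomial.aeval (MvPolynomial.X j : MvPolynomial (Fin n) ℂ) q * p) := by
  simp [atVar, h]

theorem sepOp_schurBar {n : ℕ} {Q : SymPoly n →ₗ[ℂ] SymPoly n ⊗[ℂ] ℂ[X]} (hQ : IsQOperator n Q)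
    {lam : Fin n → ℕ} (h : Antitone lam) :
    sepOp Q (schurBar lam) =
      ∏ j : Fin n, Polynomial.aeval (MvPolynomial.X j : MvPolynomial (Fin n) ℂ) (qPoly lam) := by
  have key : ∀ (l : List (Fin n)) (p : MvPolynomial (Fin n) ℂ),
      (l.map fun j => (atVar j Q :
        Module.End ℂ (SymPoly n ⊗[ℂ] MvPolynomial (Fin n) ℂ))).prod (schurBar lam ⊗ₜ[ℂ] p) =
      schurBar lam ⊗ₜ[ℂ] ((l.map fun j =>
        Polynomial.aeval (MvPolynomial.X j : MvPolynomial (Fin n) ℂ) (qPoly lam)).prod * p) := by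
    intro l p
    induction l with
    | nil => simp
    | cons j l ih =>
      rw [List.map_cons, List.prod_cons, Module.End.mul_apply, ih, atVar_tmul j Q (hQ lam h),
        List.map_cons, List.prod_cons, mul_assoc]
  have h1 := key (List.finRange n) 1
  rw [← List.ofFn_eq_map, ← List.ofFn_eq_map, List.prod_ofFn, mul_one] at h1
  simp only [sepOp, LinearMap.comp_apply, LinearMap.flip_apply, TensorProduct.mk_apply]
  rw [h1]
  simp [evalOneZ, evalOne_schurBar h]

theorem evalOne_rho {n k : ℕ} (hk : k ≤ n) (f : SymPoly n) :
    evalOne k (rho n k hk f) = evalOne n f := by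
  have : (MvPolynomial.aeval fun _ : Fin k => (1 : ℂ)).comp (restrictOne n k) =
      MvPolynomial.aeval fun _ : Fin n => (1 : ℂ) := by
    refine MvPolynomial.algHom_ext fun i => ?_
    by_cases h : (i : ℕ) < k <;> simp [restrictOne, h]
  exact congrArg (fun φ => φ (f : MvPolynomial (Fin n) ℂ)) this

theorem rho_self (n : ℕ) (f : SymPoly n) : rho n n le_rfl f = f := by
  have : restrictOne n n = AlgHom.id ℂ _ := by
    refine MvPolynomial.algHom_ext fun i => ?_
    simp [restrictOne]
  exact Subtype.ext (congrArg (fun φ => φ (f : MvPolynomial (Fin n) ℂ)) this)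

/-- Each factor trades `ρ_k s̄_λ` for `ρ_{k-1} s̄_λ ⊗ q_λ`, so the product telescopes down to `ρ_0
s̄_λ = 1`. -/
theorem chainOp_schurBar {n : ℕ} {Q : SymPoly n →ₗ[ℂ] SymPoly n ⊗[ℂ] ℂ[X]} (hQ : IsQOperator n Q)
    {A : AFamily n} (hA : Intertwines Q A) {lam : Fin n → ℕ} (h : Antitone lam) :
    chainOp A (schurBar lam) =
      ∏ j : Fin n, Polynomial.aeval (MvPolynomial.X j : MvPolynomial (Fin n) ℂ) (qPoly lam) := by
  have key : ∀ (m : ℕ) (hm : m ≤ n) (p : MvPolynomial (Fin n) ℂ),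
      chain A m hm (rho n m hm (schurBar lam) ⊗ₜ[ℂ] p) =
      rho n 0 (Nat.zero_le n) (schurBar lam) ⊗ₜ[ℂ] ((∏ j : Fin m,
        Polynomial.aeval (MvPolynomial.X (Fin.castLE hm j) : MvPolynomial (Fin n) ℂ)
          (qPoly lam)) * p) := by
    intro m
    induction m with
    | zero => intro hm p; simp [chain]
    | succ m ih =>
      intro hm p
      have hAm : A ⟨m, hm⟩ (rho n (m + 1) hm (schurBar lam)) =
          rho n m (Nat.le_of_succ_le hm) (schurBar lam) ⊗ₜ[ℂ] qPoly lam := by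
        have := congrArg (fun φ => φ (schurBar lam)) (hA ⟨m, hm⟩)
        simp only [LinearMap.comp_apply, hQ lam h, LinearMap.rTensor_tmul] at this
        exact this.symm
      rw [chain, LinearMap.comp_apply, atVar_tmul _ _ hAm, ih, Fin.prod_univ_castSucc, mul_assoc]
      rfl
  have h1 := key n le_rfl 1
  rw [rho_self, mul_one] at h1
  simp only [chainOp, LinearMap.comp_apply, LinearMap.flip_apply, TensorProduct.mk_apply]
  rw [h1]
  simp [evalOneZ, evalOne_rho, evalOne_schurBar h]

/-! ### Surjectivity of the restriction maps -/

/-- A restricted power sum is the power sum in `k` variables plus the constant `n - k`. Newton's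
identities, in characteristic zero, then put the elementary symmetric polynomials in the image, and
these generate. -/
theorem rho_surjective {n k : ℕ} (hk : k ≤ n) : Function.Surjective (rho n k hk) := by
  let S : Subalgebra ℂ (MvPolynomial (Fin k) ℂ) := (SymPoly n).map (restrictOne n k)
  have hpsum : ∀ r : ℕ, MvPolynomial.psum (Fin k) ℂ r ∈ S := by
    intro r
    have h1 : restrictOne n k (MvPolynomial.psum (Fin n) ℂ r) ∈ S :=
      ⟨_, MvPolynomial.psum_isSymmetric _ _ _, rfl⟩
    have h2 : restrictOne n k (MvPolynomial.psum (Fin n) ℂ r) =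
        MvPolynomial.psum (Fin k) ℂ r + ((n - k : ℕ) : MvPolynomial (Fin k) ℂ) := by
      obtain ⟨m, rfl⟩ := Nat.exists_eq_add_of_le hk
      simp [MvPolynomial.psum, restrictOne, Fin.sum_univ_add]
    have h3 := sub_mem h1 (natCast_mem S (n - k))
    rwa [h2, add_sub_cancel_right] at h3
  have hesymm : ∀ r : ℕ, MvPolynomial.esymm (Fin k) ℂ r ∈ S := by
    intro r
    induction r using Nat.strong_induction_on with
    | _ r ih =>
      rcases Nat.eq_zero_or_pos r with rfl | hr
      · rw [MvPolynomial.esymm_zero]; exact one_mem S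
      · have h1 : (r : MvPolynomial (Fin k) ℂ) * MvPolynomial.esymm (Fin k) ℂ r ∈ S := by
          rw [MvPolynomial.mul_esymm_eq_sum]
          refine mul_mem (pow_mem (neg_mem (one_mem S)) _) (sum_mem fun a ha => ?_)
          exact mul_mem (mul_mem (pow_mem (neg_mem (one_mem S)) _)
            (ih _ (Finset.mem_filter.1 ha).2)) (hpsum _)
        rw [← nsmul_eq_mul, ← Nat.cast_smul_eq_nsmul ℂ] at h1
        have hr' : (r : ℂ) ≠ 0 := Nat.cast_ne_zero.2 hr.ne'
        have := S.smul_mem h1 (r : ℂ)⁻¹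
        rwa [smul_smul, inv_mul_cancel₀ hr', one_smul] at this
  intro f
  obtain ⟨p, hp⟩ := MvPolynomial.esymmAlgHom_surjective (σ := Fin k) ℂ (n := k) (by simp) f
  have hf : (f : MvPolynomial (Fin k) ℂ) ∈ S := by
    rw [← hp, MvPolynomial.esymmAlgHom_apply]
    clear hp
    induction p using MvPolynomial.induction_on with
    | C a => rw [MvPolynomial.aeval_C]; exact S.algebraMap_mem a
    | add p q hp hq => rw [map_add]; exact add_mem hp hq
    | mul_X p i hp => rw [map_mul, MvPolynomial.aeval_X]; exact mul_mem hp (hesymm _)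
  obtain ⟨g, hg, hgf⟩ := hf
  exact ⟨⟨g, hg⟩, Subtype.ext hgf⟩

open MeasureTheory

/-! ### Row operations on confluent alternants -/

section RowOperations

variable {R : Type*} [CommRing R]

theorem rowDet_mul_rows {n k : ℕ} (hk : k ≤ n) (c : Fin k → R) (u : Fin k → Fin n → R)
    (w : Fin n → R) : rowDet (fun i j => c i * u i j) w = (∏ i, c i) * rowDet u w := by
  have h := prod_fin_split hk c fun _ => 1
  rw [Finset.prod_const_one, mul_one] at h
  rw [rowDet, rowDet, ← h, ← Matrix.det_mul_column]
  congr 1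
  ext i j
  by_cases hi : (i : ℕ) < k <;> simp [rowMatrix, hi]

theorem rowDet_eq_sum {k m : ℕ} (u : Fin k → Fin (k + m) → R) (w : Fin (k + m) → R) :
    rowDet u w = ∑ σ : Equiv.Perm (Fin (k + m)), ((Equiv.Perm.sign σ : ℤ) : R) *
      ((∏ i, u i (σ (Fin.castAdd m i))) * ∏ r : Fin m, w (σ (Fin.natAdd k r)) ^ (r : ℕ)) := by
  rw [rowDet, ← Matrix.det_transpose, Matrix.det_apply']
  refine Finset.sum_congr rfl fun σ _ => ?_
  rw [Fin.prod_univ_add]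
  simp [rowMatrix]

/-- If the rows of a matrix are `1 - u₀, u₀ - u₁, …, u_{m-2} - u_{m-1}, u_{m-1}` followed by
`(s - w) w ^ r`, then its determinant is that of `u₀, …, u_{m-1}, w ^ 0, w ^ 1, …`, up to sign. -/
theorem det_difference_rows {p m : ℕ} (hm : m ≤ p) (u : Fin m → Fin (p + 1) → R)
    (w : Fin (p + 1) → R) (s : R) :
    (Matrix.of fun i j : Fin (p + 1) => if h : (i : ℕ) < m + 1 then
        (Fin.cons 1 u : Fin (m + 1) → Fin (p + 1) → R) ⟨i, h⟩ j -
          (if h' : (i : ℕ) < m then u ⟨i, h'⟩ j else 0)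
        else (s - w j) * w j ^ ((i : ℕ) - (m + 1))).det = (-1) ^ p * rowDet u w := by
  let A : Matrix (Fin (p + 1)) (Fin (p + 1)) R := Matrix.of fun i j =>
    if h : (i : ℕ) < m then 1 - u ⟨i, h⟩ j else if (i : ℕ) = m then 1 else
      (s - w j) * w j ^ ((i : ℕ) - (m + 1))
  let B : Matrix (Fin (p + 1)) (Fin (p + 1)) R := Matrix.of fun i j =>
    if h : (i : ℕ) < m then - u ⟨i, h⟩ j else if (i : ℕ) = m then 1 else
      (s - w j) * w j ^ ((i : ℕ) - (m + 1))
  let C : Matrix (Fin (p + 1)) (Fin (p + 1)) R := Matrix.of fun i j =>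
    if h : (i : ℕ) < m then u ⟨i, h⟩ j else if (i : ℕ) = m then 1 else
      (w j - s) * w j ^ ((i : ℕ) - (m + 1))
  -- Partial sums of the first rows telescope to `1 - u_i`, and to `1` in row `m`.
  trans A.det
  · symm
    refine Matrix.det_eq_of_forall_row_eq_smul_add_pred
      (fun i => if (i : ℕ) < m then 1 else 0) (fun j => ?_) fun i j => ?_
    · rcases Nat.eq_zero_or_pos m with rfl | h0
      · simp [A]
      · have h1 : ((0 : Fin (p + 1)) : ℕ) < m := h0
        have h2 : ((0 : Fin (p + 1)) : ℕ) < m + 1 := m.succ_pos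
        simp only [A, Matrix.of_apply]
        rw [dif_pos h1, dif_pos h2, dif_pos h1]
        rfl
    · simp only [A, Matrix.of_apply, Fin.val_succ, Fin.val_castSucc]
      rcases lt_trichotomy ((i : ℕ) + 1) m with h | h | h
      · have h1 : (i : ℕ) < m := by omega
        have h2 : (i : ℕ) + 1 < m + 1 := by omega
        have h3 : (Fin.cons 1 u : Fin (m + 1) → Fin (p + 1) → R) ⟨i + 1, h2⟩ = u ⟨i, h1⟩ := rfl
        simp only [h, h1, h2, dite_true, if_true, h3]
        ring
      · have h0 : ¬ (i : ℕ) + 1 < m := by omega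
        have h1 : (i : ℕ) < m := by omega
        have h2 : (i : ℕ) + 1 < m + 1 := by omega
        have h3 : (Fin.cons 1 u : Fin (m + 1) → Fin (p + 1) → R) ⟨i + 1, h2⟩ = u ⟨i, h1⟩ := rfl
        rw [dif_neg h0, if_pos h, dif_pos h2, dif_neg h0, if_pos h1, dif_pos h1, h3]
        ring
      · have h0 : ¬ (i : ℕ) + 1 < m := by omega
        have h1 : ¬ (i : ℕ) < m := by omega
        have h2 : ¬ (i : ℕ) + 1 < m + 1 := by omega
        have h3 : (i : ℕ) + 1 ≠ m := by omega
        simp only [h0, h1, h2, h3, dite_false, if_false]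
        ring
  -- The constant row `m` is subtracted from the rows above it.
  trans B.det
  · refine Matrix.det_eq_of_forall_row_eq_smul_add_const
      (fun i => if (i : ℕ) < m then 1 else 0) ⟨m, by omega⟩ (by simp) fun i j => ?_
    by_cases h : (i : ℕ) < m
    · simp only [A, B, Matrix.of_apply, h, dite_true, if_true, lt_irrefl, dite_false]
      ring
    · simp [A, B, h]
  -- A sign is extracted from each of the `p` rows other than row `m`.
  trans (-1) ^ p * C.det
  · have h := Matrix.det_mul_column (fun i : Fin (p + 1) => if (i : ℕ) = m then (1 : R) else -1) C
    have h1 : ∏ i : Fin (p + 1), (if (i : ℕ) = m then (1 : R) else -1) = (-1) ^ p := by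
      rw [← Finset.mul_prod_erase _ _ (Finset.mem_univ (⟨m, by omega⟩ : Fin (p + 1)))]
      rw [Finset.prod_congr rfl (g := fun _ => (-1 : R))]
      · simp
      · intro i hi
        rw [if_neg]
        exact fun h => (Finset.mem_erase.1 hi).1 (Fin.ext h)
    rw [← h1, ← h]
    congr 1
    ext i j
    by_cases h2 : (i : ℕ) < m
    · have : (i : ℕ) ≠ m := by omega
      simp [B, C, h2, this]
    · by_cases h3 : (i : ℕ) = m
      · simp [B, C, h3]
      · simp only [B, C, h2, h3, Matrix.of_apply, dite_false, if_false]
        ring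
  -- Below row `m`, `w ^ (r + 1) = (w - s) w ^ r + s w ^ r`, so adding `s` times the preceding row
  -- restores the powers of `w`.
  · congr 1
    symm
    refine Matrix.det_eq_of_forall_row_eq_smul_add_pred
      (fun i => if (i : ℕ) < m then 0 else s) (fun j => ?_) fun i j => ?_
    · rcases Nat.eq_zero_or_pos m with rfl | h0
      · simp [C, rowMatrix]
      · simp [C, rowMatrix, h0]
    · simp only [C, rowMatrix, Matrix.of_apply, Fin.val_succ, Fin.val_castSucc]
      rcases lt_trichotomy ((i : ℕ) + 1) m with h | h | h
      · have h1 : (i : ℕ) < m := by omega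
        simp [h, h1]
      · have h0 : ¬ (i : ℕ) + 1 < m := by omega
        have h1 : (i : ℕ) < m := by omega
        simp [h, h1]
      · have h0 : ¬ (i : ℕ) + 1 < m := by omega
        have h1 : ¬ (i : ℕ) < m := by omega
        have h3 : (i : ℕ) + 1 ≠ m := by omega
        simp only [h0, h1, h3, dite_false, if_false]
        rw [show (i : ℕ) + 1 - m = ((i : ℕ) + 1 - (m + 1)) + 1 by omega,
          show (i : ℕ) - m = (i : ℕ) + 1 - (m + 1) by omega]
        ring

end RowOperations

/-! ### Negative moments of confluent alternants over the interlacing domain -/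

/-- Each variable occurs in one row only, so every term of the Leibniz expansion is a product of
functions of separate variables and Fubini applies. -/
theorem integral_rowDet {n k : ℕ} (hk : k ≤ n) (ν : Fin k → Measure ℝ) [∀ i, SigmaFinite (ν i)]
    (u : Fin k → ℝ → Fin n → ℝ) (w : Fin n → ℝ)
    (hu : ∀ i j, Integrable (fun t => u i t j) (ν i)) :
    Integrable (fun x : Fin k → ℝ => rowDet (fun i => u i (x i)) w) (Measure.pi ν) ∧
    ∫ x, rowDet (fun i => u i (x i)) w ∂Measure.pi ν =
      rowDet (fun i j => ∫ t, u i t j ∂ν i) w := by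
  obtain ⟨m, rfl⟩ := Nat.exists_eq_add_of_le hk
  have hint : ∀ σ : Equiv.Perm (Fin (k + m)), Integrable (fun x : Fin k → ℝ =>
      ((Equiv.Perm.sign σ : ℤ) : ℝ) * ((∏ i, u i (x i) (σ (Fin.castAdd m i))) *
        ∏ r : Fin m, w (σ (Fin.natAdd k r)) ^ (r : ℕ))) (Measure.pi ν) := fun σ =>
    ((Integrable.fintype_prod (f := fun i t => u i t (σ (Fin.castAdd m i)))
      fun i => hu i _).mul_const _).const_mul _
  simp only [rowDet_eq_sum]
  refine ⟨integrable_finsetSum _ fun σ _ => hint σ, ?_⟩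
  rw [integral_finsetSum _ fun σ _ => hint σ]
  refine Finset.sum_congr rfl fun σ _ => ?_
  rw [integral_const_mul, integral_mul_const,
    integral_fintype_prod_eq_prod (fun i t => u i t (σ (Fin.castAdd m i)))]

theorem integral_Ioi_inv_pow {c : ℝ} (hc : 0 < c) {s a : ℕ} (h : a < s) :
    IntegrableOn (fun t : ℝ => t⁻¹ ^ (s + 1) * t ^ a) (Set.Ioi c) ∧
    ∫ t in Set.Ioi c, t⁻¹ ^ (s + 1) * t ^ a = c⁻¹ ^ s * c ^ a / (s - a) := by
  have hsa : (a : ℝ) < s := by exact_mod_cast h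
  have hlt : (a : ℝ) - (s + 1) < -1 := by linarith
  have heq : ∀ t ∈ Set.Ioi c, t ^ ((a : ℝ) - (s + 1)) = t⁻¹ ^ (s + 1) * t ^ a := by
    intro t ht
    have ht' : 0 < t := hc.trans ht
    rw [Real.rpow_sub ht', Real.rpow_natCast, ← Nat.cast_succ, Real.rpow_natCast, inv_pow]
    field_simp
  refine ⟨(integrableOn_Ioi_rpow_of_lt hlt hc).congr_fun heq measurableSet_Ioi, ?_⟩
  rw [← setIntegral_congr_fun measurableSet_Ioi heq, integral_Ioi_rpow_of_lt hlt hc]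
  have h1 : c ^ ((a : ℝ) - (s + 1) + 1) = c⁻¹ ^ s * c ^ a := by
    rw [show (a : ℝ) - (s + 1) + 1 = a - s by ring, Real.rpow_sub hc, Real.rpow_natCast,
      Real.rpow_natCast, inv_pow]
    field_simp
  rw [h1]
  have : (s : ℝ) - a ≠ 0 := by linarith
  have h2 : (a : ℝ) - (s + 1) + 1 ≠ 0 := by linarith
  field_simp
  ring

theorem integral_Ioo_inv_pow {b c : ℝ} (hb : 0 < b) (hbc : b ≤ c) {s a : ℕ} (h : a < s) :
    ∫ t in Set.Ioo b c, t⁻¹ ^ (s + 1) * t ^ a =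
      (b⁻¹ ^ s * b ^ a - c⁻¹ ^ s * c ^ a) / (s - a) := by
  have h1 := integral_Ioi_inv_pow hb h
  have h2 := integral_Ioi_inv_pow (hb.trans_le hbc) h
  have h3 : ∫ t in Set.Ioi b, t⁻¹ ^ (s + 1) * t ^ a =
      (∫ t in Set.Ioc b c, t⁻¹ ^ (s + 1) * t ^ a) + ∫ t in Set.Ioi c, t⁻¹ ^ (s + 1) * t ^ a := by
    rw [← setIntegral_union (Set.Ioc_disjoint_Ioi le_rfl) measurableSet_Ioi
      (h1.1.mono_set Set.Ioc_subset_Ioi_self) h2.1, Set.Ioc_union_Ioi_eq_Ioi hbc]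
  rw [h1.2, h2.2, integral_Ioc_eq_integral_Ioo] at h3
  rw [sub_div, h3]
  ring

/-- The range of the `i`-th variable in `interlacing y`. -/
def slot {m : ℕ} (y : Fin m → ℝ) (i : Fin (m + 1)) : Set ℝ :=
  if h : (i : ℕ) < m then Set.Ioo ((Fin.cons 1 y : Fin (m + 1) → ℝ) i) (y ⟨i, h⟩)
  else Set.Ioi ((Fin.cons 1 y : Fin (m + 1) → ℝ) i)

theorem interlacing_eq_pi {m : ℕ} (y : Fin m → ℝ) :
    interlacing y = Set.pi Set.univ (slot y) := by
  ext x
  simp only [interlacing, Set.mem_ofPred_eq, Set.mem_pi, Set.mem_univ, true_imp_iff]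
  constructor
  · rintro ⟨h0, h⟩ i
    have hlow : (Fin.cons 1 y : Fin (m + 1) → ℝ) i < x i := by
      refine Fin.cases ?_ (fun i => ?_) i
      · exact h0
      · exact (h i).2
    by_cases hi : (i : ℕ) < m
    · simp only [slot, hi, dite_true, Set.mem_Ioo]
      exact ⟨hlow, (h ⟨i, hi⟩).1⟩
    · simpa only [slot, hi, dite_false, Set.mem_Ioi] using hlow
  · intro h
    have hlow : ∀ i, (Fin.cons 1 y : Fin (m + 1) → ℝ) i < x i := by
      intro i
      have := h i
      by_cases hi : (i : ℕ) < m
      · simp only [slot, hi, dite_true, Set.mem_Ioo] at this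
        exact this.1
      · simpa only [slot, hi, dite_false, Set.mem_Ioi] using this
    refine ⟨hlow 0, fun i => ⟨?_, hlow i.succ⟩⟩
    have := h i.castSucc
    simp only [slot, Fin.val_castSucc, i.2, dite_true, Set.mem_Ioo] at this
    exact this.2

theorem measurableSet_interlacing {m : ℕ} (y : Fin m → ℝ) : MeasurableSet (interlacing y) := by
  rw [interlacing_eq_pi]
  refine MeasurableSet.univ_pi fun i => ?_
  rw [slot]
  split_ifs
  · exact measurableSet_Ioo
  · exact measurableSet_Ioi

theorem one_le_cons {m : ℕ} {y : Fin m → ℝ} (hy : ∀ i, 1 < y i) (i : Fin (m + 1)) :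
    1 ≤ (Fin.cons 1 y : Fin (m + 1) → ℝ) i := by
  refine Fin.cases ?_ (fun i => ?_) i
  · exact le_rfl
  · exact (hy i).le

theorem slot_subset {m : ℕ} (y : Fin m → ℝ) (i : Fin (m + 1)) :
    slot y i ⊆ Set.Ioi ((Fin.cons 1 y : Fin (m + 1) → ℝ) i) := by
  rw [slot]
  split_ifs
  · exact Set.Ioo_subset_Ioi_self
  · exact subset_rfl

theorem one_le_prod_of_mem_interlacing {m : ℕ} {y : Fin m → ℝ} (hy : ∀ i, 1 < y i)
    {x : Fin (m + 1) → ℝ} (hx : x ∈ interlacing y) : 1 ≤ ∏ i, x i := by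
  rw [interlacing_eq_pi] at hx
  calc (1 : ℝ) = ∏ i : Fin (m + 1), 1 := by simp
    _ ≤ _ := Finset.prod_le_prod (fun _ _ => zero_le_one) fun i _ =>
      (one_le_cons hy i).trans (slot_subset y i (hx i (Set.mem_univ i))).le

/-- The weight is absorbed into the rows. Row `i` then integrates to a difference of endpoint values
of `t ^ (μ_j - s)` over `s - μ_j`, with lower endpoint `1` in the first row and nothing from
infinity in the last because `μ_j < s`. -/
theorem moment_confluent {p m : ℕ} (hm : m ≤ p) (mu : Fin (p + 1) → ℕ) {y : Fin m → ℝ}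
    (hy : ∀ i, 1 < y i) (hmono : StrictMono y) {s : ℕ} (hs : ∀ j, mu j < s) :
    IntegrableOn (fun x : Fin (m + 1) → ℝ => (∏ i, x i)⁻¹ ^ (s + 1) * confluent mu x)
      (interlacing y) ∧
    ∫ x in interlacing y, (∏ i, x i)⁻¹ ^ (s + 1) * confluent mu x =
      (-1) ^ p * ((∏ i, y i)⁻¹ ^ s * confluent mu y) / ∏ j, ((s : ℝ) - mu j) := by
  have hconf : ∀ x : Fin (m + 1) → ℝ, (∏ i, x i)⁻¹ ^ (s + 1) * confluent mu x =
      rowDet (fun i j => (x i)⁻¹ ^ (s + 1) * x i ^ mu j) fun j => (mu j : ℝ) := by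
    intro x
    rw [rowDet_mul_rows (by omega), confluent, Finset.prod_pow, Finset.prod_inv_distrib]
  have hvol : (volume : Measure (Fin (m + 1) → ℝ)).restrict (interlacing y) =
      Measure.pi fun i => volume.restrict (slot y i) := by
    rw [interlacing_eq_pi, volume_pi, Measure.restrict_pi_pi]
  have hpos : ∀ i, 0 < (Fin.cons 1 y : Fin (m + 1) → ℝ) i := fun i =>
    zero_lt_one.trans_le (one_le_cons hy i)
  have hrow : ∀ i j, Integrable (fun t : ℝ => t⁻¹ ^ (s + 1) * t ^ mu j)
      (volume.restrict (slot y i)) := fun i j =>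
    (integral_Ioi_inv_pow (hpos i) (hs j)).1.mono_set (slot_subset y i)
  have key := integral_rowDet (n := p + 1) (by omega) (fun i => volume.restrict (slot y i))
    (fun _ t j => t⁻¹ ^ (s + 1) * t ^ mu j) (fun j => (mu j : ℝ)) hrow
  simp only [hconf, IntegrableOn, hvol]
  refine ⟨key.1, key.2.trans ?_⟩
  have hne : ∀ j, (s : ℝ) - mu j ≠ 0 := fun j => by
    have : (mu j : ℝ) < s := by exact_mod_cast hs j
    linarith
  -- Scaling column `j` by `s - μ_j` clears the denominators and turns the rows `μ_j ^ r` into `(s -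
  -- μ_j) μ_j ^ r`, the shape required by `det_difference_rows`.
  rw [eq_div_iff (Finset.prod_ne_zero_iff.2 fun j _ => hne j), mul_comm, rowDet,
    ← Matrix.det_mul_row]
  have h2 := det_difference_rows hm (fun i j => (y i)⁻¹ ^ s * y i ^ mu j) (fun j => (mu j : ℝ)) s
  rw [rowDet_mul_rows (by omega), Finset.prod_pow, Finset.prod_inv_distrib] at h2
  rw [confluent, ← h2]
  congr 1
  ext i j
  simp only [rowMatrix, Matrix.of_apply]
  by_cases h : (i : ℕ) < m + 1
  · simp only [h, dite_true]
    have hcons : (Fin.cons 1 (fun i j => (y i)⁻¹ ^ s * y i ^ mu j) :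
        Fin (m + 1) → Fin (p + 1) → ℝ) ⟨i, h⟩ j =
        ((Fin.cons 1 y : Fin (m + 1) → ℝ) ⟨i, h⟩)⁻¹ ^ s *
          (Fin.cons 1 y : Fin (m + 1) → ℝ) ⟨i, h⟩ ^ mu j := by
      generalize (⟨i, h⟩ : Fin (m + 1)) = l
      refine Fin.cases ?_ (fun l => ?_) l <;> simp
    rw [hcons]
    by_cases h' : (i : ℕ) < m
    · simp only [slot, h', dite_true]
      rw [integral_Ioo_inv_pow (hpos _) _ (hs j), mul_div_cancel₀ _ (hne j)]
      have hlt : ∀ (l : Fin (m + 1)) (hl : (l : ℕ) < m),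
          (Fin.cons 1 y : Fin (m + 1) → ℝ) l ≤ y ⟨l, hl⟩ := by
        intro l
        refine Fin.cases ?_ (fun l => ?_) l
        · intro hl; exact (hy _).le
        · intro hl; exact (hmono (by simp [Fin.lt_def])).le
      exact hlt ⟨i, h⟩ h'
    · simp only [slot, h', dite_false]
      rw [(integral_Ioi_inv_pow (hpos _) (hs j)).2, mul_div_cancel₀ _ (hne j), sub_zero]
  · simp only [h, dite_false]

theorem moment_confluent_one {p : ℕ} (mu : Fin (p + 1) → ℕ) (x₀ : Fin 0 → ℝ) {s : ℕ}
    (hs : ∀ j, mu j < s) :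
    IntegrableOn (fun t : ℝ => t⁻¹ ^ (s + 1) * confluent mu fun _ : Fin 1 => t) (Set.Ioi 1) ∧
    ∫ t in Set.Ioi (1 : ℝ), t⁻¹ ^ (s + 1) * confluent mu (fun _ : Fin 1 => t) =
      (-1) ^ p * confluent mu x₀ / ∏ j, ((s : ℝ) - mu j) := by
  have h : IntegrableOn (fun x : Fin 1 → ℝ => (∏ i, x i)⁻¹ ^ (s + 1) * confluent mu x)
      (interlacing x₀) ∧
      ∫ x : Fin 1 → ℝ in interlacing x₀, (∏ i, x i)⁻¹ ^ (s + 1) * confluent mu x =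
        (-1) ^ p * ((∏ i, x₀ i)⁻¹ ^ s * confluent mu x₀) / ∏ j, ((s : ℝ) - mu j) :=
    moment_confluent (Nat.zero_le p) mu (fun i => i.elim0) (fun i => i.elim0) hs
  have hmp := (volume_preserving_funUnique (Fin 1) ℝ).symm
  have hpre : (MeasurableEquiv.funUnique (Fin 1) ℝ).symm ⁻¹' interlacing x₀ = Set.Ioi 1 := by
    ext t
    simp [interlacing, MeasurableEquiv.funUnique]
  have hfun : ∀ t : ℝ, (MeasurableEquiv.funUnique (Fin 1) ℝ).symm t = fun _ => t := fun t => rfl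
  have h1 := (hmp.integrableOn_comp_preimage (MeasurableEquiv.measurableEmbedding _)).2 h.1
  have h2 := (hmp.setIntegral_preimage_emb (MeasurableEquiv.measurableEmbedding _) _ _).trans h.2
  rw [hpre] at h1 h2
  simp only [Function.comp_def, hfun] at h1 h2
  exact ⟨by simpa using h1, by simpa using h2⟩

/-! ### Comparing integrals through their moments -/

section Moments

variable {X Y : Type*} [MeasurableSpace X] [MeasurableSpace Y] {μ : Measure X} {ν : Measure Y}

theorem integrable_comp_mul {u H : X → ℝ} (hu : AEStronglyMeasurable u μ)
    (hu01 : ∀ᵐ x ∂μ, u x ∈ Set.Icc (0 : ℝ) 1) (hH : Integrable H μ) {ψ : ℝ → ℝ}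
    (hψ : Continuous ψ) : Integrable (fun x => ψ (u x) * H x) μ := by
  obtain ⟨C, hC⟩ := isCompact_Icc.exists_bound_of_continuousOn
    (hψ.continuousOn (s := Set.Icc (0 : ℝ) 1))
  exact hH.bdd_mul (hψ.comp_aestronglyMeasurable hu) (hu01.mono fun x hx => hC _ hx)

theorem abs_integral_comp_sub_le {u H : X → ℝ} (hu : AEStronglyMeasurable u μ)
    (hu01 : ∀ᵐ x ∂μ, u x ∈ Set.Icc (0 : ℝ) 1) (hH : Integrable H μ) {ψ χ : ℝ → ℝ}
    (hψ : Continuous ψ) (hχ : Continuous χ) {ε : ℝ}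
    (hε : ∀ x ∈ Set.Icc (0 : ℝ) 1, |χ x - ψ x| < ε) :
    |∫ x, χ (u x) * H x ∂μ - ∫ x, ψ (u x) * H x ∂μ| ≤ ε * ∫ x, |H x| ∂μ := by
  rw [← integral_sub (integrable_comp_mul hu hu01 hH hχ) (integrable_comp_mul hu hu01 hH hψ),
    ← Real.norm_eq_abs, ← integral_const_mul]
  refine norm_integral_le_of_norm_le (hH.abs.const_mul _) (hu01.mono fun x hx => ?_)
  rw [← sub_mul, norm_mul, Real.norm_eq_abs, Real.norm_eq_abs]
  exact mul_le_mul_of_nonneg_right (hε _ hx).le (abs_nonneg _)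

theorem integral_comp_eq_of_moments {u H : X → ℝ} {v K : Y → ℝ} (hu : AEStronglyMeasurable u μ)
    (hu01 : ∀ᵐ x ∂μ, u x ∈ Set.Icc (0 : ℝ) 1) (hH : Integrable H μ)
    (hv : AEStronglyMeasurable v ν) (hv01 : ∀ᵐ x ∂ν, v x ∈ Set.Icc (0 : ℝ) 1)
    (hK : Integrable K ν)
    (hmom : ∀ r : ℕ, ∫ x, u x ^ r * H x ∂μ = ∫ x, v x ^ r * K x ∂ν) {ψ : ℝ → ℝ}
    (hψ : Continuous ψ) : ∫ x, ψ (u x) * H x ∂μ = ∫ x, ψ (v x) * K x ∂ν := by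
  have hpoly : ∀ P : Polynomial ℝ,
      ∫ x, P.eval (u x) * H x ∂μ = ∫ x, P.eval (v x) * K x ∂ν := by
    intro P
    induction P using Polynomial.induction_on' with
    | add p q hp hq =>
      simp only [Polynomial.eval_add, add_mul]
      rw [integral_add, integral_add, hp, hq]
      · exact integrable_comp_mul hv hv01 hK p.continuous
      · exact integrable_comp_mul hv hv01 hK q.continuous
      · exact integrable_comp_mul hu hu01 hH p.continuous
      · exact integrable_comp_mul hu hu01 hH q.continuous
    | monomial r a =>
      simp only [Polynomial.eval_monomial, mul_assoc, integral_const_mul, hmom r]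
  set S : ℝ := (∫ x, |H x| ∂μ) + ∫ x, |K x| ∂ν with hS
  have hS0 : 0 ≤ S := add_nonneg (integral_nonneg fun _ => abs_nonneg _)
    (integral_nonneg fun _ => abs_nonneg _)
  refine eq_of_abs_sub_le_all fun ε hε => ?_
  obtain ⟨P, hP⟩ := exists_polynomial_near_of_continuousOn 0 1 ψ hψ.continuousOn (ε / (S + 1))
    (by positivity)
  have h1 := abs_integral_comp_sub_le hu hu01 hH hψ P.continuous hP
  have h2 := abs_integral_comp_sub_le hv hv01 hK hψ P.continuous hP
  rw [hpoly P] at h1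
  calc _ ≤ ε / (S + 1) * (∫ x, |H x| ∂μ) + ε / (S + 1) * ∫ x, |K x| ∂ν := by
        rw [abs_le] at h1 h2 ⊢
        constructor <;> linarith [h1.1, h1.2, h2.1, h2.2]
    _ = ε * (S / (S + 1)) := by rw [hS]; ring
    _ ≤ ε * 1 := by
        refine mul_le_mul_of_nonneg_left ?_ hε.le
        rw [div_le_one (by positivity)]
        linarith
    _ = ε := mul_one ε

theorem continuous_inv_pow_mul_comp_inv {φ : ℝ → ℝ} (hφ : Continuous φ) (hc : HasCompactSupport φ)
    (N : ℕ) : Continuous fun u : ℝ => u⁻¹ ^ (N + 1) * φ u⁻¹ := by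
  rw [continuous_iff_continuousAt]
  intro u
  rcases eq_or_ne u 0 with rfl | hu
  · obtain ⟨R, hR⟩ := hc.isCompact.isBounded.subset_closedBall 0
    have hz : (fun u : ℝ => u⁻¹ ^ (N + 1) * φ u⁻¹) =ᶠ[𝓝 0] fun _ => 0 := by
      have hR' : 0 < (|R| + 1)⁻¹ := by positivity
      filter_upwards [Metric.ball_mem_nhds (0 : ℝ) hR'] with v hv
      -- Away from `0`, the point `v⁻¹` has left the support. At `0` the convention `0⁻¹ = 0` gives
      -- the value `0`, as the exponent `N + 1` is positive.
      rcases eq_or_ne v 0 with rfl | hv0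
      · simp
      · rw [image_eq_zero_of_notMem_tsupport (f := φ), mul_zero]
        intro h
        have h1 := hR h
        rw [mem_closedBall_zero_iff, norm_inv] at h1
        rw [mem_ball_zero_iff] at hv
        have h2 : |R| + 1 < ‖v‖⁻¹ := by
          rw [lt_inv_comm₀ (by positivity) (norm_pos_iff.2 hv0)]
          exact hv
        linarith [le_abs_self R]
    exact (continuousAt_const (y := (0 : ℝ))).congr hz.symm
  · exact ((continuousAt_inv₀ hu).pow _).mul
      (ContinuousAt.comp (f := fun u : ℝ => u⁻¹) hφ.continuousAt (continuousAt_inv₀ hu))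

/-- Two weighted pushforwards to `[1, ∞)` whose negative moments of large order agree have the
same integrals against compactly supported continuous functions. -/
theorem integral_comp_eq_of_neg_moments {p G : X → ℝ} {q K : Y → ℝ}
    (hp : AEStronglyMeasurable p μ) (hp1 : ∀ᵐ x ∂μ, 1 ≤ p x)
    (hq : AEStronglyMeasurable q ν) (hq1 : ∀ᵐ x ∂ν, 1 ≤ q x) (N : ℕ)
    (hG : Integrable (fun x => (p x)⁻¹ ^ (N + 1) * G x) μ)
    (hK : Integrable (fun x => (q x)⁻¹ ^ (N + 1) * K x) ν)
    (hmom : ∀ s : ℕ, N ≤ s →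
      ∫ x, (p x)⁻¹ ^ (s + 1) * G x ∂μ = ∫ x, (q x)⁻¹ ^ (s + 1) * K x ∂ν)
    {φ : ℝ → ℝ} (hφ : Continuous φ) (hc : HasCompactSupport φ) :
    Integrable (fun x => φ (p x) * G x) μ ∧
      ∫ x, φ (p x) * G x ∂μ = ∫ x, φ (q x) * K x ∂ν := by
  -- In the variable `u = p⁻¹`, which lies in `[0, 1]`, one has `φ(p) G = ψ(u) (u ^ (N + 1) G)` with
  -- `ψ(u) = u⁻¹ ^ (N + 1) φ(u⁻¹)`. The weighted function is integrable, and its moments in `u` are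
  -- the assumed negative moments.
  have hψ := continuous_inv_pow_mul_comp_inv hφ hc N
  have h01 : ∀ t : ℝ, 1 ≤ t → t⁻¹ ∈ Set.Icc (0 : ℝ) 1 := fun t ht =>
    ⟨inv_nonneg.2 (zero_le_one.trans ht), inv_le_one_of_one_le₀ ht⟩
  have hcancel : ∀ t g : ℝ, 1 ≤ t →
      t⁻¹⁻¹ ^ (N + 1) * φ t⁻¹⁻¹ * (t⁻¹ ^ (N + 1) * g) = φ t * g := by
    intro t g ht
    have : t ≠ 0 := by linarith
    rw [inv_inv, inv_pow]
    field_simp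
  have hpi : AEStronglyMeasurable (fun x => (p x)⁻¹) μ :=
    hp.aemeasurable.inv.aestronglyMeasurable
  have hqi : AEStronglyMeasurable (fun x => (q x)⁻¹) ν :=
    hq.aemeasurable.inv.aestronglyMeasurable
  have e1 : (fun x => (p x)⁻¹⁻¹ ^ (N + 1) * φ (p x)⁻¹⁻¹ * ((p x)⁻¹ ^ (N + 1) * G x)) =ᵐ[μ]
      fun x => φ (p x) * G x := hp1.mono fun x hx => hcancel _ _ hx
  have e2 : (fun x => (q x)⁻¹⁻¹ ^ (N + 1) * φ (q x)⁻¹⁻¹ * ((q x)⁻¹ ^ (N + 1) * K x)) =ᵐ[ν]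
      fun x => φ (q x) * K x := hq1.mono fun x hx => hcancel _ _ hx
  have i1 := integrable_comp_mul hpi (hp1.mono fun x hx => h01 _ hx) hG hψ
  refine ⟨i1.congr e1, ?_⟩
  rw [← integral_congr_ae e1, ← integral_congr_ae e2]
  refine integral_comp_eq_of_moments hpi (hp1.mono fun x hx => h01 _ hx) hG hqi
    (hq1.mono fun x hx => h01 _ hx) hK (fun r => ?_) hψ
  have := hmom (N + r) (Nat.le_add_right _ _)
  rw [show N + r + 1 = r + (N + 1) by omega] at this
  simpa only [pow_add _ r, mul_assoc] using this

end Moments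

/-! ### Approximate identities -/

theorem tendsto_integral_approx_delta {h : ℝ → ℝ} (hh : Continuous h) {z P : ℝ} (hz : 1 < z)
    (hP : 0 < P) {η : ℝ → ℝ} (hη : Continuous η) (hc : HasCompactSupport η)
    (h1 : ∫ s, η s = 1) :
    Filter.Tendsto (fun ε : ℝ => ∫ t in Set.Ioi 1, ε⁻¹ * η ((t * P - z * P) / ε) * h t)
      (𝓝[>] 0) (𝓝 (P⁻¹ * h z)) := by
  -- The substitution `t = z + (ε / P) v` turns the argument of `η` into `v` and leaves the Jacobian
  -- factor `P⁻¹`.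
  let F : ℝ → ℝ → ℝ := fun ε v =>
    P⁻¹ * (η v * (Set.Ioi (1 : ℝ)).indicator h (z + ε / P * v))
  have hF : ∀ ε : ℝ, 0 < ε →
      ∫ t in Set.Ioi 1, ε⁻¹ * η ((t * P - z * P) / ε) * h t = ∫ v, F ε v := by
    intro ε hε
    rw [← integral_indicator measurableSet_Ioi]
    have e1 : ∀ t, (Set.Ioi (1 : ℝ)).indicator
        (fun t => ε⁻¹ * η ((t * P - z * P) / ε) * h t) t =
        ε⁻¹ * η ((t * P - z * P) / ε) * (Set.Ioi (1 : ℝ)).indicator h t := fun t =>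
      Set.indicator_mul_right _ (fun t => ε⁻¹ * η ((t * P - z * P) / ε)) h
    simp only [e1]
    rw [← integral_add_left_eq_self _ z]
    have e2 := Measure.integral_comp_mul_left (fun t : ℝ =>
      ε⁻¹ * η (((z + t) * P - z * P) / ε) * (Set.Ioi (1 : ℝ)).indicator h (z + t)) (ε / P)
    have hpos : (0 : ℝ) < (ε / P)⁻¹ := by positivity
    rw [abs_of_pos hpos, smul_eq_mul, ← inv_mul_eq_iff_eq_mul₀ hpos.ne'] at e2
    rw [← e2, ← integral_const_mul]
    refine integral_congr_ae (Filter.Eventually.of_forall fun v => ?_)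
    have e3 : ((z + ε / P * v) * P - z * P) / ε = v := by
      field_simp
      ring
    simp only [F, e3]
    field_simp
  have hlim : ∫ v, P⁻¹ * (η v * h z) = P⁻¹ * h z := by
    rw [integral_const_mul, integral_mul_const, h1, one_mul]
  have hev : ∀ᶠ ε : ℝ in 𝓝[>] 0, 0 < ε ∧ ε < 1 := by
    filter_upwards [self_mem_nhdsWithin, mem_nhdsWithin_of_mem_nhds (Iio_mem_nhds one_pos)] with
      ε h1 h2 using ⟨h1, h2⟩
  refine Filter.Tendsto.congr' (hev.mono fun ε hε => (hF ε hε.1).symm) ?_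
  rw [← hlim]
  obtain ⟨R, hR⟩ := hc.isCompact.isBounded.subset_closedBall 0
  obtain ⟨C, hC⟩ := (isCompact_closedBall z (|R| / P)).exists_bound_of_continuousOn
    hh.continuousOn
  have hmeas : Measurable ((Set.Ioi (1 : ℝ)).indicator h) :=
    hh.measurable.indicator measurableSet_Ioi
  refine tendsto_integral_filter_of_dominated_convergence (fun v => P⁻¹ * (|η v| * C))
    (Filter.Eventually.of_forall fun ε => ?_) (hev.mono fun ε hε => ?_) ?_ ?_
  · exact ((hη.measurable.mul (hmeas.comp (by fun_prop))).const_mul _).aestronglyMeasurable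
  · refine Filter.Eventually.of_forall fun v => ?_
    by_cases hv : v ∈ tsupport η
    · have hv' := hR hv
      rw [mem_closedBall_zero_iff] at hv'
      have hmem : z + ε / P * v ∈ Metric.closedBall z (|R| / P) := by
        rw [Metric.mem_closedBall, Real.dist_eq, add_sub_cancel_left, abs_mul, abs_div,
          abs_of_pos hε.1, abs_of_pos hP, div_mul_eq_mul_div]
        gcongr
        rw [← Real.norm_eq_abs v]
        calc ε * ‖v‖ ≤ 1 * ‖v‖ := by gcongr; exact hε.2.le
          _ ≤ |R| := by rw [one_mul]; exact hv'.trans (le_abs_self R)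
      simp only [F, norm_mul, Real.norm_eq_abs, abs_of_pos (inv_pos.2 hP)]
      gcongr
      exact (norm_indicator_le_norm_self h _).trans (hC _ hmem)
    · simp [F, image_eq_zero_of_notMem_tsupport hv]
  · exact ((hη.integrable_of_hasCompactSupport hc).abs.mul_const _).const_mul _
  · refine Filter.Eventually.of_forall fun v => ?_
    have hcont : ContinuousAt ((Set.Ioi (1 : ℝ)).indicator h) z :=
      hh.continuousAt.congr <| Filter.eventuallyEq_of_mem (Ioi_mem_nhds hz)
        fun t ht => (Set.indicator_of_mem ht h).symm
    have h2 : Filter.Tendsto (fun ε : ℝ => z + ε / P * v) (𝓝[>] 0) (𝓝 z) := by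
      have : Filter.Tendsto (fun ε : ℝ => z + ε / P * v) (𝓝 0) (𝓝 (z + 0 / P * v)) :=
        Continuous.tendsto (by fun_prop) 0
      rw [zero_div, zero_mul, add_zero] at this
      exact this.mono_left nhdsWithin_le_nhds
    have h3 := hcont.tendsto.comp h2
    rw [Set.indicator_of_mem (show z ∈ Set.Ioi 1 from hz)] at h3
    exact (h3.const_mul _).const_mul _

/-! ### The delta integral of a confluent alternant -/

theorem ofReal_vdm {m : ℕ} (x : Fin m → ℝ) : ((vdm x : ℝ) : ℂ) = vdm fun i => (x i : ℂ) := by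
  simp [vdm]

theorem ofReal_confluent {n k : ℕ} (mu : Fin n → ℕ) (x : Fin k → ℝ) :
    ((confluent mu x : ℝ) : ℂ) = confluent mu fun i => (x i : ℂ) :=
  map_confluent Complex.ofRealHom mu x

theorem continuous_confluent {n k : ℕ} (mu : Fin n → ℕ) :
    Continuous fun x : Fin k → ℝ => confluent mu x := by
  refine Continuous.matrix_det ?_
  refine continuous_matrix fun i j => ?_
  by_cases h : (i : ℕ) < k <;> simp only [rowMatrix, Matrix.of_apply, h, dite_true, dite_false] <;>
    fun_prop

theorem hasCompactSupport_rescale {η : ℝ → ℝ} (hc : HasCompactSupport η) (a : ℝ) {ε : ℝ}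
    (hε : ε ≠ 0) : HasCompactSupport fun t => ε⁻¹ * η ((t - a) / ε) := by
  have h := (hc.comp_homeomorph
    ((Homeomorph.addRight (-a)).trans (Homeomorph.mulRight₀ ε⁻¹ (inv_ne_zero hε)))).mul_left
    (f := fun _ => ε⁻¹)
  simp only [sub_eq_add_neg, div_eq_mul_inv]
  exact h

theorem hasDeltaIntegral_confluent {p m : ℕ} (hm : m ≤ p) {mu : Fin (p + 1) → ℕ}
    (hmu : Function.Injective mu) {y : Fin m → ℝ} (hy : ∀ i, 1 < y i) (hmono : StrictMono y)
    {z : ℝ} (hz : 1 < z) (x₀ : Fin 0 → ℝ) (c : ℂ) :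
    HasDeltaIntegral (interlacing y) (fun x => (∏ i, x i) - z * ∏ i, y i)
      (fun x => c * (confluent mu x : ℝ))
      (c * (confluent mu y / confluent mu x₀ * confluent mu (fun _ : Fin 1 => z) : ℝ)) := by
  intro η hη hc h1
  set P : ℝ := ∏ i, y i with hP
  set D : ℝ → ℝ := fun t => confluent mu fun _ : Fin 1 => t with hD
  set K : ℝ := confluent mu y / confluent mu x₀ with hK
  have hP1 : 1 ≤ P := by
    calc (1 : ℝ) = ∏ i : Fin m, 1 := by simp
      _ ≤ _ := Finset.prod_le_prod (fun _ _ => zero_le_one) fun i _ => (hy i).le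
  have hP0 : 0 < P := zero_lt_one.trans_le hP1
  have hx₀ : confluent mu x₀ ≠ 0 := by
    have := confluent_zero_ne_zero hmu fun i => ((x₀ i : ℝ) : ℂ)
    rw [← ofReal_confluent] at this
    exact_mod_cast this
  have hDc : Continuous D := (continuous_confluent mu).comp (by fun_prop)
  have hs : ∀ s, Finset.univ.sup mu + 1 ≤ s → ∀ j, mu j < s := fun s hs j =>
    Nat.lt_of_succ_le ((Nat.succ_le_succ (Finset.le_sup (Finset.mem_univ j))).trans hs)
  -- The density `K P D(t)` over `t P` is chosen so that its moments match those of `confluent mu`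
  -- over `∏ x`; the extra `P` later cancels the Jacobian of the delta function.
  have hscale : ∀ (s : ℕ) (t : ℝ), (t * P)⁻¹ ^ (s + 1) * (K * P * D t) =
      K * P⁻¹ ^ s * (t⁻¹ ^ (s + 1) * D t) := by
    intro s t
    rw [mul_inv, mul_pow, pow_succ P⁻¹]
    field_simp
  have main : ∀ ε : ℝ, 0 < ε →
      Integrable (fun x : Fin (m + 1) → ℝ => ε⁻¹ * η (((∏ i, x i) - z * P) / ε) * confluent mu x)
        (volume.restrict (interlacing y)) ∧
      ∫ x in interlacing y, ε⁻¹ * η (((∏ i, x i) - z * P) / ε) * confluent mu x =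
        K * P * ∫ t in Set.Ioi 1, ε⁻¹ * η ((t * P - z * P) / ε) * D t := by
    intro ε hε
    have h := integral_comp_eq_of_neg_moments (μ := volume.restrict (interlacing y))
      (ν := volume.restrict (Set.Ioi (1 : ℝ))) (p := fun x : Fin (m + 1) → ℝ => ∏ i, x i)
      (G := fun x => confluent mu x) (q := fun t => t * P) (K := fun t => K * P * D t)
      (Continuous.aestronglyMeasurable (by fun_prop))
      ((ae_restrict_iff' (measurableSet_interlacing y)).2
        (Filter.Eventually.of_forall fun x hx => one_le_prod_of_mem_interlacing hy hx))
      (Continuous.aestronglyMeasurable (by fun_prop))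
      ((ae_restrict_iff' measurableSet_Ioi).2
        (Filter.Eventually.of_forall fun t ht => one_le_mul_of_one_le_of_one_le
          (le_of_lt ht) hP1))
      (Finset.univ.sup mu + 1)
      (moment_confluent hm mu hy hmono (hs _ le_rfl)).1
      (by
        simp only [hscale]
        exact (moment_confluent_one mu x₀ (hs _ le_rfl)).1.const_mul _)
      (fun s hs' => by
        rw [(moment_confluent hm mu hy hmono (hs _ hs')).2]
        simp only [hscale]
        rw [integral_const_mul, (moment_confluent_one mu x₀ (hs _ hs')).2, hK, ← hP]
        field_simp)
      (φ := fun t => ε⁻¹ * η ((t - z * P) / ε))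
      (by have := hη.continuous; fun_prop) (hasCompactSupport_rescale hc _ hε.ne')
    refine ⟨h.1, h.2.trans ?_⟩
    rw [← integral_const_mul]
    exact integral_congr_ae (Filter.Eventually.of_forall fun t => by ring)
  have hfun : ∀ ε : ℝ, (fun x : Fin (m + 1) → ℝ =>
      (ε⁻¹ * η (((∏ i, x i) - z * P) / ε)) • (c * ((confluent mu x : ℝ) : ℂ))) =
      fun x => c * ((ε⁻¹ * η (((∏ i, x i) - z * P) / ε) * confluent mu x : ℝ) : ℂ) := by
    intro ε
    ext x
    rw [Complex.real_smul, Complex.ofReal_mul (_ * _)]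
    ring
  simp only [hfun]
  refine ⟨?_, ?_⟩
  · filter_upwards [self_mem_nhdsWithin] with ε hε
    exact (main ε hε).1.ofReal.const_mul c
  · have hlim := (((tendsto_integral_approx_delta hDc hz hP0 hη.continuous hc h1).const_mul
      (K * P)).ofReal).const_mul c
    rw [show K * P * (P⁻¹ * D z) = K * D z by field_simp] at hlim
    refine hlim.congr' ?_
    filter_upwards [self_mem_nhdsWithin] with ε hε
    rw [integral_const_mul, integral_complex_ofReal, (main ε hε).2]

section DeltaIntegral

variable {ι : Type} [Fintype ι] {Ω : Set (ι → ℝ)} {g : (ι → ℝ) → ℝ} {F G : (ι → ℝ) → ℂ} {I J : ℂ}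

theorem HasDeltaIntegral.add (hF : HasDeltaIntegral Ω g F I) (hG : HasDeltaIntegral Ω g G J) :
    HasDeltaIntegral Ω g (fun x => F x + G x) (I + J) := by
  intro η hη hc h1
  obtain ⟨a1, a2⟩ := hF η hη hc h1
  obtain ⟨b1, b2⟩ := hG η hη hc h1
  simp only [smul_add]
  refine ⟨?_, (a2.add b2).congr' ?_⟩
  · filter_upwards [a1, b1] with ε h2 h3 using h2.add h3
  · filter_upwards [a1, b1] with ε h2 h3 using (integral_add h2 h3).symm

theorem HasDeltaIntegral.const_mul (hF : HasDeltaIntegral Ω g F I) (c : ℂ) :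
    HasDeltaIntegral Ω g (fun x => c * F x) (c * I) := by
  intro η hη hc h1
  obtain ⟨a1, a2⟩ := hF η hη hc h1
  simp only [← mul_smul_comm]
  refine ⟨?_, (a2.const_mul c).congr fun ε => (integral_const_mul _ _).symm⟩
  filter_upwards [a1] with ε h2 using h2.const_mul c

/-- A normalized bump function is an admissible `η`, so the definition is not vacuous and limits are
unique. -/
theorem HasDeltaIntegral.unique (hF : HasDeltaIntegral Ω g F I) (hG : HasDeltaIntegral Ω g F J) :
    I = J := by
  let b : ContDiffBump (0 : ℝ) := ⟨1, 2, one_pos, one_lt_two⟩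
  have h1 := b.contDiff_normed (μ := volume) (n := ⊤)
  have h2 := b.hasCompactSupport_normed (μ := volume)
  have h3 := b.integral_normed (μ := volume)
  exact tendsto_nhds_unique (hF _ h1 h2 h3).2 (hG _ h1 h2 h3).2

theorem hasDeltaIntegral_zero : HasDeltaIntegral Ω g (fun _ => 0) 0 := by
  intro η _ _ _
  simp

end DeltaIntegral

/-! ### The kernel of the intertwining operators -/

theorem aeval_restrictOne {n k : ℕ} (y : Fin k → ℂ) (f : MvPolynomial (Fin n) ℂ) :
    MvPolynomial.aeval y (restrictOne n k f) = MvPolynomial.aeval (padOne n y) f := by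
  have : (MvPolynomial.aeval y).comp (restrictOne n k) =
      (MvPolynomial.aeval (padOne n y) : MvPolynomial (Fin n) ℂ →ₐ[ℂ] ℂ) := by
    refine MvPolynomial.algHom_ext fun i => ?_
    by_cases h : (i : ℕ) < k <;> simp [restrictOne, padOne, h]
  exact congrArg (fun φ => φ f) this

theorem aeval_qPoly {n : ℕ} (lam : Fin n → ℕ) (z : ℂ) :
    Polynomial.aeval z (qPoly lam) = MvPolynomial.aeval (padOne n fun _ : Fin 1 => z)
      (schurBar lam : MvPolynomial (Fin n) ℂ) := by
  have : (Polynomial.aeval z).comp (MvPolynomial.aeval (fun i : Fin n =>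
      if (i : ℕ) = 0 then (Polynomial.X : ℂ[X]) else 1)) =
      (MvPolynomial.aeval (padOne n fun _ : Fin 1 => z) : MvPolynomial (Fin n) ℂ →ₐ[ℂ] ℂ) := by
    refine MvPolynomial.algHom_ext fun i => ?_
    by_cases h : (i : ℕ) = 0 <;> simp [padOne, h]
  exact congrArg (fun φ => φ (schurBar lam : MvPolynomial (Fin n) ℂ)) this

/-- The weight in `kernelFun` is exactly the denominator of the padded Schur function. -/
theorem kernelFun_rho {n m : ℕ} (hm : m + 1 ≤ n) {lam : Fin n → ℕ} (h : Antitone lam)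
    (x₀ : Fin 0 → ℂ) (x : Fin (m + 1) → ℝ) :
    kernelFun n m (rho n (m + 1) hm (schurBar lam)) x =
      vdm (fun i : Fin n => (i : ℂ)) / vdm (fun i : Fin (n - (m + 1)) => (i : ℂ)) /
        confluent (shifted lam) x₀ * (confluent (shifted lam) x : ℝ) := by
  rw [ofReal_confluent, ← schurBar_padOne hm h, ← aeval_restrictOne, kernelFun, mul_comm]
  push_cast
  rw [ofReal_vdm]
  rfl

/-- Formulated with `ρ_{k-1} Q F` rather than `A_k`, so that it can serve to prove that `A_k`
exists. Both sides are linear in `F`, which leaves the case of `s̄_λ`. -/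
theorem hasDeltaIntegral_kernelFun {n m : ℕ} (hm : m + 1 ≤ n)
    {Q : SymPoly n →ₗ[ℂ] SymPoly n ⊗[ℂ] ℂ[X]} (hQ : IsQOperator n Q) {y : Fin m → ℝ}
    (hy : ∀ i, 1 < y i) (hmono : StrictMono y) {z : ℝ} (hz : 1 < z) (F : SymPoly n) :
    ∃ I : ℂ, HasDeltaIntegral (interlacing y) (fun x => (∏ i, x i) - z * (∏ i, y i))
        (kernelFun n m (rho n (m + 1) hm F)) I ∧
      valueAt (fun i => (y i : ℂ)) (z : ℂ)
        ((rho n m (Nat.le_of_succ_le hm)).rTensor ℂ[X] (Q F)) = (kernelConst n m z y : ℂ) * I := by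
  have hF : F ∈ Submodule.span ℂ (Set.range fun lam : {lam : Fin n → ℕ // Antitone lam} =>
      schurBar lam.1) := by rw [span_schurBar]; trivial
  induction hF using Submodule.span_induction with
  | mem F hF =>
    obtain ⟨⟨lam, h⟩, rfl⟩ := hF
    obtain ⟨p, rfl⟩ : ∃ p, n = p + 1 := ⟨n - 1, by omega⟩
    let x₀ : Fin 0 → ℝ := Fin.elim0
    have hinj := (shifted_strictAnti h).injective
    have hfun := funext (kernelFun_rho hm h fun i => ((x₀ i : ℝ) : ℂ))
    refine ⟨_, hfun ▸ hasDeltaIntegral_confluent (Nat.le_of_succ_le_succ hm) hinj hy hmono hz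
      x₀ _, ?_⟩
    obtain ⟨r, rfl⟩ := Nat.exists_eq_add_of_le (Nat.le_of_succ_le_succ hm)
    have h1 := schurBar_padOne (Nat.le_of_succ_le hm) h (fun i => (y i : ℂ))
      fun i => ((x₀ i : ℝ) : ℂ)
    have h2 := schurBar_padOne (k := 1) (by omega) h (fun _ => (z : ℂ))
      fun i => ((x₀ i : ℝ) : ℂ)
    have e1 : m + r + 1 - (m + 1) = r := by omega
    have e2 : m + r + 1 - m = r + 1 := by omega
    have hval : valueAt (fun i => (y i : ℂ)) (z : ℂ)
        ((rho (m + r + 1) m (Nat.le_of_succ_le hm)).rTensor ℂ[X] (Q (schurBar lam))) =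
        MvPolynomial.aeval (padOne (m + r + 1) fun i => (y i : ℂ))
            (schurBar lam : MvPolynomial (Fin (m + r + 1)) ℂ) *
          MvPolynomial.aeval (padOne (m + r + 1) fun _ : Fin 1 => (z : ℂ))
            (schurBar lam : MvPolynomial (Fin (m + r + 1)) ℂ) := by
      rw [hQ lam h, LinearMap.rTensor_tmul, ← aeval_qPoly, ← aeval_restrictOne]
      rfl
    have hv1 : vdm (fun _ : Fin 1 => (z : ℂ)) = 1 := by simp [vdm]
    rw [hv1, one_mul, Fin.prod_univ_one, Nat.add_sub_cancel, vdm_natCast_succ (m + r)] at h2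
    rw [e2, vdm_natCast_succ r, vdm_natCast_succ (m + r)] at h1
    rw [hval, kernelConst, e1, e2, Nat.add_sub_cancel, vdm_natCast_succ (m + r)]
    push_cast
    rw [ofReal_vdm, ofReal_confluent, ofReal_confluent, ofReal_confluent]
    have n1 := vdm_natCast_ne_zero r
    have n2 := vdm_natCast_ne_zero (m + r)
    have n3 := confluent_zero_ne_zero hinj fun i => ((x₀ i : ℝ) : ℂ)
    have n4 : vdm (fun i => (y i : ℂ)) ≠ 0 :=
      vdm_ne_zero (Complex.ofReal_injective.comp hmono.injective)
    have n5 : ∏ i, ((y i : ℂ) - 1) ^ (r + 1) ≠ 0 :=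
      Finset.prod_ne_zero_iff.2 fun i _ => pow_ne_zero _ <| sub_ne_zero.2 <| by
        exact_mod_cast (hy i).ne'
    have n6 : ((z : ℂ) - 1) ^ (m + r) ≠ 0 :=
      pow_ne_zero _ <| sub_ne_zero.2 <| by exact_mod_cast hz.ne'
    have n7 : (r.factorial : ℂ) ≠ 0 := Nat.cast_ne_zero.2 r.factorial_ne_zero
    have n8 : ((m + r).factorial : ℂ) ≠ 0 := Nat.cast_ne_zero.2 (m + r).factorial_ne_zero
    rw [← eq_div_iff (mul_ne_zero n4 n5)] at h1
    rw [← eq_div_iff n6] at h2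
    -- The Vandermonde constants leave `(-1)^(m+r) (m+r)! / ((-1)^r r!)`, which is the sign and
    -- factorial ratio of `kernelConst`.
    rw [h1, h2, pow_add (-1 : ℂ) m r]
    have n10 : ((-1 : ℂ)) ^ r ≠ 0 := pow_ne_zero _ (by simp)
    have n11 : ((-1 : ℂ)) ^ m ≠ 0 := pow_ne_zero _ (by simp)
    field_simp
  | zero =>
    refine ⟨0, ?_, by simp⟩
    have hk : kernelFun n m (rho n (m + 1) hm 0) = fun _ => 0 := by
      ext x
      simp [kernelFun]
    rw [hk]
    exact hasDeltaIntegral_zero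
  | add F G _ _ hF hG =>
    obtain ⟨I, hI, hI'⟩ := hF
    obtain ⟨J, hJ, hJ'⟩ := hG
    refine ⟨I + J, ?_, by rw [map_add, map_add, map_add, hI', hJ', mul_add]⟩
    convert hI.add hJ using 1
    ext x
    simp [kernelFun, mul_add]
  | smul c F _ hF =>
    obtain ⟨I, hI, hI'⟩ := hF
    refine ⟨c * I, ?_, by
      rw [map_smul, map_smul, map_smul, hI', smul_eq_mul, mul_left_comm]⟩
    convert hI.const_mul c using 1
    ext x
    simp [kernelFun, mul_left_comm]

/-! ### Existence and uniqueness of the intertwining family -/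

/-- Expand in powers of `z`. For fixed `y` a polynomial in `z` with infinitely many roots vanishes,
so each coefficient vanishes on a product of infinite sets and is zero. -/
theorem eq_zero_of_valueAt_eq_zero {m : ℕ} (t : SymPoly m ⊗[ℂ] ℂ[X])
    (h : ∀ (y : Fin m → ℝ) (z : ℝ), (∀ i, 1 < y i) → StrictMono y → 1 < z →
      valueAt (fun i => (y i : ℂ)) (z : ℂ) t = 0) : t = 0 := by
  obtain ⟨c, rfl⟩ := TensorProduct.eq_repr_basis_right (Polynomial.basisMonomials ℂ) t
  have hc : c = 0 := by
    ext1 r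
    refine Subtype.ext ?_
    -- The intervals `(i + 1, i + 2)` are disjoint and ordered, so every point of the box is
    -- increasing with coordinates above `1`.
    refine MvPolynomial.funext_set (s := fun i : Fin m =>
      (fun t : ℝ => (t : ℂ)) '' Set.Ioo ((i : ℝ) + 1) (i + 2))
      (fun i => (Set.Ioo_infinite (by linarith)).image Complex.ofReal_injective.injOn) ?_
    intro Y hY
    choose y hy hyY using fun i => hY i (Set.mem_univ i)
    have hY' : Y = fun i => (y i : ℂ) := funext fun i => (hyY i).symm
    have hy1 : ∀ i, 1 < y i := fun i => by
      have : (0 : ℝ) ≤ (i : ℕ) := Nat.cast_nonneg _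
      linarith [(hy i).1]
    have hmono : StrictMono y := by
      intro i j hij
      have : ((i : ℕ) : ℝ) + 1 ≤ (j : ℕ) := by exact_mod_cast hij
      linarith [(hy i).2, (hy j).1]
    let P : ℂ[X] := c.sum fun r f => Polynomial.monomial r
      (MvPolynomial.eval Y (f : MvPolynomial (Fin m) ℂ))
    have hP : P = 0 := by
      refine Polynomial.eq_zero_of_infinite_isRoot _ (Set.Infinite.mono ?_
        ((Set.Ioi_infinite (1 : ℝ)).image Complex.ofReal_injective.injOn))
      rintro _ ⟨z, hz, rfl⟩
      have h0 := h y z hy1 hmono hz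
      rw [← hY'] at h0
      simp only [Finsupp.sum, map_sum] at h0
      simp only [Set.mem_ofPred_eq, Polynomial.IsRoot, P, Finsupp.sum, Polynomial.eval_finsetSum]
      rw [← h0]
      refine Finset.sum_congr rfl fun r _ => ?_
      simp [valueAt]
    have h2 := congrArg (fun q => Polynomial.coeff q r) hP
    simp only [P, Finsupp.sum, Polynomial.finsetSum_coeff, Polynomial.coeff_monomial,
      Polynomial.coeff_zero, Finset.sum_ite_eq'] at h2
    by_cases hr : r ∈ c.support
    · simpa [hr] using h2
    · simp [Finsupp.notMem_support_iff.1 hr]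
  rw [hc]
  simp

theorem existsUnique_intertwines {n : ℕ} {Q : SymPoly n →ₗ[ℂ] SymPoly n ⊗[ℂ] ℂ[X]}
    (hQ : IsQOperator n Q) : ∃! A : AFamily n, Intertwines Q A := by
  -- If `ρ_k F = 0`, the integrand is zero, so all values of `ρ_{k-1} Q F` on the admissible region
  -- vanish.
  have hker : ∀ (j : Fin n) (F : SymPoly n), rho n (j + 1) j.2 F = 0 →
      (rho n j j.2.le).rTensor ℂ[X] (Q F) = 0 := by
    intro j F hF
    refine eq_zero_of_valueAt_eq_zero _ fun y z hy hmono hz => ?_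
    obtain ⟨I, hI, hI'⟩ := hasDeltaIntegral_kernelFun j.2 hQ hy hmono hz F
    have hk : kernelFun n j (rho n (j + 1) j.2 F) = fun _ => 0 := by
      ext x
      simp [hF, kernelFun]
    rw [hk] at hI
    rw [hI', hI.unique hasDeltaIntegral_zero, mul_zero]
  -- A linear section of `ρ_k` defines `A_k`; by `hker` the choice of section does not matter.
  choose s hs using fun j : Fin n => LinearMap.exists_rightInverse_of_surjective
    (rho n (j + 1) j.2) (LinearMap.range_eq_top.2 (rho_surjective j.2))
  refine ⟨fun j => (rho n j j.2.le).rTensor ℂ[X] ∘ₗ Q ∘ₗ s j, fun j => ?_, fun A hA => ?_⟩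
  · ext1 F
    have h := hker j (F - s j (rho n (j + 1) j.2 F)) (by
      rw [map_sub, sub_eq_zero]
      exact (congrArg (fun φ => φ (rho n (j + 1) j.2 F)) (hs j)).symm)
    rw [map_sub, map_sub, sub_eq_zero] at h
    exact h
  · funext j
    ext1 f
    obtain ⟨F, rfl⟩ := rho_surjective j.2 f
    have h1 := congrArg (fun φ => φ F) (hA j)
    have h := hker j (F - s j (rho n (j + 1) j.2 F)) (by
      rw [map_sub, sub_eq_zero]
      exact (congrArg (fun φ => φ (rho n (j + 1) j.2 F)) (hs j)).symm)
    rw [map_sub, map_sub, sub_eq_zero] at h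
    exact h1.symm.trans h

end SchurSep

theorem mainTheorem3 (n : ℕ) (hn : 1 ≤ n) :
    (∃! Q : SymPoly n →ₗ[ℂ] SymPoly n ⊗[ℂ] ℂ[X], IsQOperator n Q) ∧
    ∀ Q : SymPoly n →ₗ[ℂ] SymPoly n ⊗[ℂ] ℂ[X], IsQOperator n Q →
      (∀ lam : Fin n → ℕ, Antitone lam →
        sepOp Q (schurBar lam) =
          ∏ j : Fin n, Polynomial.aeval (MvPolynomial.X j : MvPolynomial (Fin n) ℂ) (qPoly lam)) ∧
      (∃! A : AFamily n, Intertwines Q A) ∧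
      ∀ A : AFamily n, Intertwines Q A →
        sepOp Q = chainOp A ∧
        ∀ (j : Fin n) (f : SymPoly ((j : ℕ) + 1)) (y : Fin (j : ℕ) → ℝ) (z : ℝ),
          (∀ i, 1 < y i) → StrictMono y → 1 < z →
          ∃ I : ℂ,
            HasDeltaIntegral (interlacing y) (fun x => (∏ i, x i) - z * (∏ i, y i))
              (kernelFun n j f) I ∧
            valueAt (fun i => (y i : ℂ)) (z : ℂ) (A j f) = (kernelConst n j z y : ℂ) * I := by
  refine ⟨existsUnique_isQOperator n, fun Q hQ => ⟨fun lam h => sepOp_schurBar hQ h,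
    existsUnique_intertwines hQ, fun A hA => ⟨ext_schurBar fun lam h => ?_, ?_⟩⟩⟩
  · rw [sepOp_schurBar hQ h, chainOp_schurBar hQ hA h]
  · intro j f y z hy hmono hz
    obtain ⟨F, rfl⟩ := rho_surjective j.2 f
    obtain ⟨I, hI, hI'⟩ := hasDeltaIntegral_kernelFun j.2 hQ hy hmono hz F
    refine ⟨I, hI, ?_⟩
    rw [← hI']
    exact congrArg (fun φ => valueAt (fun i => (y i : ℂ)) (z : ℂ) (φ F)) (hA j).symm
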